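/- Let $\Omega\subset\mathbb{R}^2$ be a bounded regular open set (for instance a bounded Yin set) whose boundary is a finite union of Jordan curves $\gamma_1,\dots,\gamma_r$ with $\Omega$ on their left, each piecewise $C^1$ up to the end points of its pieces with nonvanishing derivative (for instance piecewise cubic); kinks are allowed. Let $a,b,c$ be real with $b^2-4ac<0$, $\mathcal{L}u=au_{xx}+bu_{xy}+cu_{yy}$, $\mathcal{N}$ a Dirichlet, Neumann or Robin boundary operator, $\epsilon\in(0,1)$, $h>0$. *Cut cells.* Cut $\Omega$ by the grid cells $\mathbf{C}_{\mathbf i}=(\mathbf{i}h,(\mathbf{i}+\mathbf{1})h)$, $\mathbf i\in\mathbb{Z}^2$, and merge: while some $\mathbf{C}_{\mathbf i}\cap\Omega$ has several connected components, all but one of maximal volume are merged (regularized union) into components of the four neighboring cut cells with touching closure, the target being one for which the merged volume is closest to $h^2$; then cut cells of volume $<\epsilon h^2$ are merged into neighbors by the same rule. Let $\mathcal{C}_{\mathbf i}$ be the resulting cut cells, each of at most one (tracked) component, and each of volume $\ge\epsilon h^2$ if nonempty. $\mathcal{C}_{\mathbf i}$ is *regular* if $\mathcal{C}_{\mathbf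 i}=\mathbf{C}_{\mathbf i}$. If a face of $\mathbf{C}_{\mathbf i}$ lies in $\partial\Omega$ and $\mathcal{C}_{\mathbf i}$ and the next three cells in the direction away from that face are regular, the two positions beyond the face are *ghost cells*. A nonempty $\mathcal{C}_{\mathbf i}$ is an *SFV cell* if all cells of its stencil $\{\mathbf i+m\mathbf e^d: |m|\le2,\ d=1,2\}$ (if $b=0$), or $\{\mathbf i+m_1\mathbf e^1+m_2\mathbf e^2:|m_1|,|m_2|\le2\}$ (if $b\neq0$), are regular or ghost cells; otherwise it is a *PLG cell*. *The block $A_{22}$.* For each PLG cell $\mathbf i$ choose a set $T(\mathbf i)$ of $15$ indices of nonempty cut cells, contained in some box of $R\times R$ cells that contains $\mathbf i$ ($R$ fixed, e.g. $R=5$), on which Lagrange interpolation by bivariate polynomials of total degree $\le4$ is uniquely solvable. The average of $\mathcal{L}u$ over $\mathcal{C}_{\mathbf i}$ is approximated by the linear combination of the cell averages of $u$ over $T(\mathbf i)$ and, if $\mathcal{C}_{\mathbf i}$ is not regular, the average of $\mathcal{N}u$ over $\partial\mathcal{C}_{\mathbf i}\cap\partial\Omega$, with coefficients $WM^{\top}(MWM^{\top})^{-1}\overline{\phi}$.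 Here $M$ holds these averages of the basis $((x-p)/h)^{\alpha}$, $|\alpha|\le4$ ($p$ the center of $\mathbf{C}_{\mathbf i}$), $\overline\phi$ holds the averages of $\mathcal{L}$ of the basis over $\mathcal{C}_{\mathbf i}$, and $W^{-1}$ is diagonal with entries $\max\{\|\mathbf j-\mathbf i\|_2,\tfrac12\}$ for $\mathbf j\in T(\mathbf i)$ and $\tfrac12$ for the boundary average. $A_{22}\in\mathbb{R}^{m\times m}$ consists of the coefficients of the averages over PLG cells in the rows of the PLG cells. Attach each PLG cell to a curve $\gamma_c$ carrying a point $\gamma_c(s)$, $s\in[0,1)$, of $\partial\Omega$ closest to the center of $\mathbf{C}_{\mathbf i}$; the cells attached to one curve are numbered consecutively by increasing $s$ (ties broken arbitrarily). *The factorization.* Call a square matrix of size $n$ *banded up to corners with width $p$* if its $(i,j)$ entry vanishes whenever $|i-j|>p$, except in the upper right and lower left $p\times p$ corners. With $k=\min(p,n)$, write it as $\begin{bmatrix}B&P\\Q&S\end{bmatrix}$, $S\in\mathbb{R}^{k\times k}$, and factor it by (a) banded Gaussian elimination without pivoting, $B=L_BU_B$; (b) solving $L_BX=P$ by forward substitutions;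 (c) solving $YU_B=Q$ by substitutions; (d) forming $S'=S-YX$ and its LU factorization $S'=L_SU_S$. The cost is the number of additions, subtractions, multiplications and divisions performed. **Theorem.** 1. There is $C$, depending only on $\Omega$ and its boundary curves, such that $m\le C\,h^{-1}$ for all $h\in(0,1]$, all $\epsilon,\mathcal{L},\mathcal{N}$ and every output of the merging. 2. Suppose moreover that the curves $\gamma_c$ are pairwise disjoint and have no cusps (incoming and outgoing tangent directions are nowhere opposite). Then for every $R$ there are $C$, $p$ and $h_0>0$, depending only on $\Omega$, its boundary curves and $R$, such that for all $h\in(0,h_0]$ and all choices above: $m\le C\,h^{-1}$; $A_{22}$ is block diagonal with one block per boundary curve, and each block is banded up to corners with width $p$; the factorization (a)–(d) of all these blocks (for a single boundary curve, of $A_{22}$ itself) costs at most $C\,h^{-1}$ operations; and, if in each block all leading principal minors of order less than the size of the block are nonzero, it yields a unit lower triangular and an upper triangular factor of each block, and the block diagonal matrices $L_{22}$, $U_{22}$ of these factors satisfy $A_{22}=L_{22}U_{22}$. -/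

import Mathlib

open MeasureTheory Filter Topology Set

noncomputable section

/-! ## The domain and its boundary curves -/

/-- The Euclidean plane. -/
abbrev Plane := EuclideanSpace ℝ (Fin 2)

/-- A piecewise continuously differentiable Jordan curve, parametrized by the interval from 0
to 1. Every piece is continuously differentiable up to its end points with nowhere vanishing
derivative; different pieces may meet at a kink. Closed cubic splines are a special case. -/
structure JordanCurve where
  toFun : ℝ → Plane
  pieces : ℕ
  knot : Fin (pieces + 1) → ℝ
  piece : Fin pieces → ℝ → Plane
  knot_strictMono : StrictMono knot
  knot_zero : knot 0 = 0
  knot_last : knot (Fin.last pieces) = 1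
  piece_contDiff : ∀ k, ContDiff ℝ 1 (piece k)
  piece_regular : ∀ k, ∀ t ∈ Icc (knot k.castSucc) (knot k.succ), deriv (piece k) t ≠ 0
  eq_piece : ∀ k, ∀ t ∈ Icc (knot k.castSucc) (knot k.succ), toFun t = piece k t
  closed : toFun 0 = toFun 1
  injOn : InjOn toFun (Ico 0 1)

namespace JordanCurve

/-- The set of points of the curve. -/
def trace (γ : JordanCurve) : Set Plane := γ.toFun '' Icc 0 1

/-- The curve has no cusp: the incoming and the outgoing tangent direction at a point of the
curve are never opposite to each other (kinks are allowed). -/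
def NoCusp (γ : JordanCurve) : Prop :=
  (∀ t ∈ Ioo (0 : ℝ) 1,
    ¬ SameRay ℝ (derivWithin γ.toFun (Iic t) t) (-derivWithin γ.toFun (Ici t) t)) ∧
  ¬ SameRay ℝ (derivWithin γ.toFun (Iic 1) 1) (-derivWithin γ.toFun (Ici 0) 0)

/-- The unit normal on the right of the direction of travel (defined off the kinks). -/
def normal (γ : JordanCurve) (t : ℝ) : Plane :=
  ‖deriv γ.toFun t‖⁻¹ • !₂[deriv γ.toFun t 1, -(deriv γ.toFun t 0)]

end JordanCurve

/-- `Ω` is a bounded regular open set, its boundary is the union of the Jordan curves `γ c`, and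
the curves are oriented so that `Ω` lies on their left; hence `(γ c).normal` is the outward unit
normal of `Ω`. -/
structure IsDomainWithBoundary {r : ℕ} (Ω : Set Plane) (γ : Fin r → JordanCurve) : Prop where
  bounded : Bornology.IsBounded Ω
  regularOpen : interior (closure Ω) = Ω
  frontier_eq : frontier Ω = ⋃ c, (γ c).trace
  left_side : ∀ c, ∀ᵐ t : ℝ, t ∈ Ioo (0 : ℝ) 1 →
    ∀ᶠ δ : ℝ in 𝓝[>] 0, (γ c).toFun t - δ • (γ c).normal t ∈ Ω

/-! ## Grid, cut cells and cell merging -/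

/-- Multi-indices of the Cartesian grid. -/
abbrev Idx := Fin 2 → ℤ

/-- The unit multi-index along dimension `d`. -/
def unitIdx (d : Fin 2) : Idx := Pi.single d 1

/-- The open square control volume of index `i` on the grid of size `h`. -/
def gridCell (h : ℝ) (i : Idx) : Set Plane :=
  {x | ∀ d, (i d : ℝ) * h < x d ∧ x d < ((i d : ℝ) + 1) * h}

/-- The center of a control volume. -/
def cellCenter (h : ℝ) (i : Idx) : Plane := WithLp.toLp 2 fun d => ((i d : ℝ) + 1 / 2) * h

/-- The lower face of the control volume `i` along dimension `d`, without its end points. -/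
def lowerFace (h : ℝ) (i : Idx) (d : Fin 2) : Set Plane :=
  {x | x d = (i d : ℝ) * h ∧ ∀ e ≠ d, (i e : ℝ) * h < x e ∧ x e < ((i e : ℝ) + 1) * h}

/-- The higher face of the control volume `i` along dimension `d`, without its end points. -/
def higherFace (h : ℝ) (i : Idx) (d : Fin 2) : Set Plane := lowerFace h (i + unitIdx d) d

/-- The exterior of a set: the interior of its complement. -/
def exteriorSet (S : Set Plane) : Set Plane := interior Sᶜ

/-- The regularized union of two sets: the exterior of the exterior of their union. -/
def regUnion (S T : Set Plane) : Set Plane := exteriorSet (exteriorSet (S ∪ T))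

/-- A state of the merging algorithm: for every index the set of the current components of the
cut cell with that index. A cut cell without components is empty. -/
abbrev CutState := Idx → Set (Set Plane)

/-- The initial state: the connected components of the intersections of `Ω` with the cells. -/
def initialState (Ω : Set Plane) (h : ℝ) : CutState := fun i =>
  {K | ∃ x ∈ gridCell h i ∩ Ω, K = connectedComponentIn (gridCell h i ∩ Ω) x}

/-- The components, in the four neighboring cells, whose closure meets the closure of the
component `K` of the cut cell `i`. -/
def neighborComponents (σ : CutState) (i : Idx) (K : Set Plane) : Set (Idx × Set Plane) :=
  {q | q.2 ∈ σ q.1 ∧ ∑ d, |q.1 d - i d| = 1 ∧ (closure K ∩ closure q.2).Nonempty}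

/-- `q` is a neighboring component for which the volume after merging is closest to `h ^ 2`. -/
def IsBestTarget (h : ℝ) (σ : CutState) (i : Idx) (K : Set Plane) (q : Idx × Set Plane) : Prop :=
  q ∈ neighborComponents σ i K ∧ ∀ q' ∈ neighborComponents σ i K,
    |volume.real q.2 + volume.real K - h ^ 2| ≤ |volume.real q'.2 + volume.real K - h ^ 2|

open Classical in
/-- Remove the component `K` from the cut cell `i` and merge it into the component `q.2` of the
cut cell `q.1`. -/
def mergeInto (σ : CutState) (i : Idx) (K : Set Plane) (q : Idx × Set Plane) : CutState :=
  fun j =>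
    if j = q.1 then insert (regUnion q.2 K) (σ j \ {q.2})
    else if j = i then σ j \ {K} else σ j

/-- One step of the merging algorithm. As long as some cut cell has several components, a
component of such a cell other than one of maximal volume is merged into a neighboring component.
When every cut cell has at most one component, cut cells of volume less than `ε h ^ 2` are merged
into a neighboring cell. The order of the steps and the choice between equally good targets are
left open. -/
inductive MergeStep (h ε : ℝ) : CutState → CutState → Prop
  | split (σ : CutState) (i : Idx) (K M : Set Plane) (q : Idx × Set Plane)
      (hK : K ∈ σ i) (hM : M ∈ σ i) (hKM : K ≠ M)
      (hmax : ∀ K' ∈ σ i, volume.real K' ≤ volume.real M)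
      (hq : IsBestTarget h σ i K q) : MergeStep h ε σ (mergeInto σ i K q)
  | small (σ : CutState) (i : Idx) (K : Set Plane) (q : Idx × Set Plane)
      (hσ : ∀ j, (σ j).Subsingleton) (hK : K ∈ σ i) (hsmall : volume.real K < ε * h ^ 2)
      (hq : IsBestTarget h σ i K q) : MergeStep h ε σ (mergeInto σ i K q)

/-- `𝒞` is an output of the merging algorithm: every cut cell has at most one component, and its
volume is at least `ε h ^ 2`. Empty cut cells are represented by the empty set. -/
def IsMergedCutCells (Ω : Set Plane) (h ε : ℝ) (𝒞 : Idx → Set Plane) : Prop :=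
  ∃ σ : CutState, Relation.ReflTransGen (MergeStep h ε) (initialState Ω h) σ ∧
    (∀ i, (σ i).Subsingleton) ∧ (∀ i, ∀ K ∈ σ i, ε * h ^ 2 ≤ volume.real K) ∧
    ∀ i, 𝒞 i = ⋃₀ σ i

/-! ## SFV cells and PLG cells -/

/-- The boundary condition, with its constants in the Robin case. -/
inductive BoundaryCondition
  | dirichlet
  | neumann
  | robin (α₁ α₂ : ℝ)

/-- A constant-coefficient elliptic operator `a u_xx + b u_xy + c u_yy` with a boundary
condition. -/
structure EllipticProblem where
  a : ℝ
  b : ℝ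
  c : ℝ
  elliptic : b ^ 2 - 4 * a * c < 0
  bc : BoundaryCondition

/-- A regular cell is a cut cell that fills its control volume. -/
def IsRegularCell (h : ℝ) (𝒞 : Idx → Set Plane) (i : Idx) : Prop := 𝒞 i = gridCell h i

/-- The cell `i` is extendable in the high direction along dimension `d`. -/
def ExtendableHigh (Ω : Set Plane) (h : ℝ) (𝒞 : Idx → Set Plane) (i : Idx) (d : Fin 2) : Prop :=
  higherFace h i d ⊆ frontier Ω ∧
    ∀ k : Fin 4, IsRegularCell h 𝒞 (i - ((k : ℕ) : ℤ) • unitIdx d)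

/-- The cell `i` is extendable in the low direction along dimension `d`. -/
def ExtendableLow (Ω : Set Plane) (h : ℝ) (𝒞 : Idx → Set Plane) (i : Idx) (d : Fin 2) : Prop :=
  lowerFace h i d ⊆ frontier Ω ∧
    ∀ k : Fin 4, IsRegularCell h 𝒞 (i + ((k : ℕ) : ℤ) • unitIdx d)

/-- Ghost cells: two of them are appended to every extendable face of an extendable cell. -/
def IsGhostCell (Ω : Set Plane) (h : ℝ) (𝒞 : Idx → Set Plane) (j : Idx) : Prop :=
  ∃ i d,
    (ExtendableHigh Ω h 𝒞 i d ∧ (j = i + unitIdx d ∨ j = i + (2 : ℤ) • unitIdx d)) ∨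
    (ExtendableLow Ω h 𝒞 i d ∧ (j = i - unitIdx d ∨ j = i - (2 : ℤ) • unitIdx d))

/-- The symmetric finite-volume stencil: a cross if `b = 0`, a 5-by-5 box otherwise. -/
def symmetricStencil (b : ℝ) (i : Idx) : Set Idx :=
  {j | (b = 0 ∧ ∃ d, ∃ m : ℤ, |m| ≤ 2 ∧ j = i + m • unitIdx d) ∨
    (b ≠ 0 ∧ ∃ m₁ m₂ : ℤ, |m₁| ≤ 2 ∧ |m₂| ≤ 2 ∧ j = i + m₁ • unitIdx 0 + m₂ • unitIdx 1)}

/-- The indices of the PLG cells: the nonempty cut cells whose symmetric stencil contains a cell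
that is neither regular nor a ghost cell. All other nonempty cut cells are SFV cells. -/
def plgCells (Ω : Set Plane) (E : EllipticProblem) (h : ℝ) (𝒞 : Idx → Set Plane) : Set Idx :=
  {i | (𝒞 i).Nonempty ∧
    ¬ ∀ j ∈ symmetricStencil E.b i, IsRegularCell h 𝒞 j ∨ IsGhostCell Ω h 𝒞 j}

/-! ## The discretization on PLG cells -/

/-- A finite set of nodes is poised for bivariate polynomials of total degree at most 4: Lagrange
interpolation on it is uniquely solvable. -/
def IsPoised (T : Finset Idx) : Prop :=
  ∀ f : Idx → ℝ, ∃! q : MvPolynomial (Fin 2) ℝ,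
    q.totalDegree ≤ 4 ∧ ∀ j ∈ T, MvPolynomial.eval (fun d => (j d : ℝ)) q = f j

/-- `T` is a poised lattice for the cell `i`: a poised set of 15 nonempty cut cells, chosen from
some box of `R` by `R` cells that contains `i`. -/
def IsPLGStencil (R : ℕ) (𝒞 : Idx → Set Plane) (i : Idx) (T : Finset Idx) : Prop :=
  (∃ o : Idx, (∀ d, o d ≤ i d ∧ i d < o d + R) ∧ ∀ j ∈ T, ∀ d, o d ≤ j d ∧ j d < o d + R) ∧
    (∀ j ∈ T, (𝒞 j).Nonempty) ∧ T.card = 15 ∧ IsPoised T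

/-- Partial derivative along dimension `d`. -/
def partialDeriv (d : Fin 2) (u : Plane → ℝ) (x : Plane) : ℝ :=
  fderiv ℝ u x (EuclideanSpace.single d 1)

/-- The elliptic operator applied to `u`. -/
def EllipticProblem.op (E : EllipticProblem) (u : Plane → ℝ) (x : Plane) : ℝ :=
  E.a * partialDeriv 0 (partialDeriv 0 u) x + E.b * partialDeriv 0 (partialDeriv 1 u) x +
    E.c * partialDeriv 1 (partialDeriv 1 u) x

/-- The boundary operator applied to `u` at a boundary point `x` with outward unit normal `n`. -/
def BoundaryCondition.op (N : BoundaryCondition) (u : Plane → ℝ) (x n : Plane) : ℝ :=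
  match N with
  | .dirichlet => u x
  | .neumann => fderiv ℝ u x n
  | .robin α₁ α₂ => α₁ * u x + α₂ * fderiv ℝ u x n

/-- Exponents of the monomials of total degree at most 4. -/
abbrev Expo := {α : Fin 2 → Fin 5 // (α 0 : ℕ) + (α 1 : ℕ) ≤ 4}

/-- The monomial basis, scaled by `h` and centered at the center of the cell `i`. -/
def basisFun (h : ℝ) (i : Idx) (α : Expo) (x : Plane) : ℝ :=
  ∏ d, ((x d - cellCenter h i d) / h) ^ (α.1 d : ℕ)

/-- The parameters of the points of `γ` on the cut boundary of `i`, which is the part of the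
boundary of `Ω` on the boundary of the cut cell. -/
def cutBoundaryParams (Ω : Set Plane) (γ : JordanCurve) (𝒞 : Idx → Set Plane) (i : Idx) : Set ℝ :=
  {t | t ∈ Ioo (0 : ℝ) 1 ∧ γ.toFun t ∈ frontier (𝒞 i) ∩ frontier Ω}

/-- The average of `N u` over the cut boundary of `i` with respect to arc length. -/
def boundaryAvg {r : ℕ} (Ω : Set Plane) (γ : Fin r → JordanCurve) (N : BoundaryCondition)
    (𝒞 : Idx → Set Plane) (i : Idx) (u : Plane → ℝ) : ℝ :=
  (∑ c, ∫ t in cutBoundaryParams Ω (γ c) 𝒞 i, ‖deriv (γ c).toFun t‖)⁻¹ *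
    ∑ c, ∫ t in cutBoundaryParams Ω (γ c) 𝒞 i,
      N.op u ((γ c).toFun t) ((γ c).normal t) * ‖deriv (γ c).toFun t‖

open Classical in
/-- The sample matrix of the cell `i` with stencil `T`: its columns are the cell averages of the
basis over the stencil cells and (index `none`) the boundary average. For a regular cell the last
column is dropped; this is expressed by a zero column, which gives the same coefficients. -/
def sampleMatrix {r : ℕ} (Ω : Set Plane) (γ : Fin r → JordanCurve) (E : EllipticProblem) (h : ℝ)
    (𝒞 : Idx → Set Plane) (i : Idx) (T : Finset Idx) : Matrix Expo (Option T) ℝ :=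
  fun α s => match s with
    | some j => ⨍ x in 𝒞 j, basisFun h i α x
    | none => if IsRegularCell h 𝒞 i then 0 else boundaryAvg Ω γ E.bc 𝒞 i (basisFun h i α)

/-- The diagonal weight matrix `W`; the weights of `W⁻¹` are the distances of the indices, bounded
below by `1 / 2`, and `1 / 2` for the boundary average. -/
def weightMatrix (i : Idx) (T : Finset Idx) : Matrix (Option T) (Option T) ℝ :=
  Matrix.diagonal fun s => match s with
    | some j => (max (Real.sqrt (∑ d, ((j.1 d : ℝ) - (i d : ℝ)) ^ 2)) (1 / 2))⁻¹
    | none => (1 / 2 : ℝ)⁻¹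

/-- The coefficients `W Mᵀ (M W Mᵀ)⁻¹ φ` of the approximation of the cell average of the elliptic
operator over the PLG cell `i`. -/
def plgCoeffs {r : ℕ} (Ω : Set Plane) (γ : Fin r → JordanCurve) (E : EllipticProblem) (h : ℝ)
    (𝒞 : Idx → Set Plane) (i : Idx) (T : Finset Idx) : Option T → ℝ :=
  let M := sampleMatrix Ω γ E h 𝒞 i T
  let W := weightMatrix i T
  (W * M.transpose * (M * W * M.transpose)⁻¹).mulVec
    fun α => ⨍ x in 𝒞 i, E.op (basisFun h i α) x

/-- The coefficient of the cell average over `j` in the equation of the PLG cell `i`. -/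
def plgEntry {r : ℕ} (Ω : Set Plane) (γ : Fin r → JordanCurve) (E : EllipticProblem) (h : ℝ)
    (𝒞 : Idx → Set Plane) (T : Idx → Finset Idx) (i j : Idx) : ℝ :=
  if hj : j ∈ T i then plgCoeffs Ω γ E h 𝒞 i (T i) (some ⟨j, hj⟩) else 0

/-! ## The ordering of the PLG cells and the matrix -/

/-- An ordering of the PLG cells. Every PLG cell is attached to a boundary curve that carries a
boundary point closest to the center of the cell. The cells attached to the same curve are
numbered consecutively in the order of the parameters of these closest points. -/
structure PLGOrdering {r : ℕ} (Ω : Set Plane) (γ : Fin r → JordanCurve) (E : EllipticProblem)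
    (h : ℝ) (𝒞 : Idx → Set Plane) where
  size : Fin r → ℕ
  cell : (Σ c, Fin (size c)) → Idx
  param : (c : Fin r) → Fin (size c) → ℝ
  cell_injective : Function.Injective cell
  range_cell : Set.range cell = plgCells Ω E h 𝒞
  param_mem : ∀ c k, param c k ∈ Ico (0 : ℝ) 1
  closest : ∀ c k, ∀ x ∈ frontier Ω,
    dist (cellCenter h (cell ⟨c, k⟩)) ((γ c).toFun (param c k)) ≤
      dist (cellCenter h (cell ⟨c, k⟩)) x
  param_monotone : ∀ c, Monotone (param c)

namespace PLGOrdering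

variable {r : ℕ} {Ω : Set Plane} {γ : Fin r → JordanCurve} {E : EllipticProblem}
  {h : ℝ} {𝒞 : Idx → Set Plane}

/-- The block of the discrete system whose rows and columns belong to the PLG cells. -/
def A22 (o : PLGOrdering Ω γ E h 𝒞) (T : Idx → Finset Idx) :
    Matrix (Σ c, Fin (o.size c)) (Σ c, Fin (o.size c)) ℝ :=
  fun x y => plgEntry Ω γ E h 𝒞 T (o.cell x) (o.cell y)

/-- The diagonal block of `A22` that belongs to the PLG cells near the curve `γ c`. -/
def A22Block (o : PLGOrdering Ω γ E h 𝒞) (T : Idx → Finset Idx) (c : Fin r) :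
    Matrix (Fin (o.size c)) (Fin (o.size c)) ℝ :=
  fun k l => o.A22 T ⟨c, k⟩ ⟨c, l⟩

end PLGOrdering

/-- Up to two square blocks of dimension at most `p` in its upper right and its lower left corner,
the matrix has bandwidth at most `p`. -/
def IsBandedUpToCorners {n : ℕ} (p : ℕ) (A : Matrix (Fin n) (Fin n) ℝ) : Prop :=
  ∀ i j : Fin n, A i j ≠ 0 →
    ((i : ℕ) ≤ j + p ∧ (j : ℕ) ≤ i + p) ∨
    ((i : ℕ) < p ∧ n ≤ (j : ℕ) + p) ∨ ((j : ℕ) < p ∧ n ≤ (i : ℕ) + p)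

/-! ## The LU factorization with operation count -/

/-- The result of a computation with the number of arithmetic operations it has performed. -/
structure Counted (α : Type) where
  val : α
  cost : ℕ

instance : Monad Counted where
  pure x := ⟨x, 0⟩
  bind x f := ⟨(f x.val).val, x.cost + (f x.val).cost⟩

/-- Subtraction, one operation. -/
def opSub (x y : ℝ) : Counted ℝ := ⟨x - y, 1⟩

/-- Multiplication, one operation. -/
def opMul (x y : ℝ) : Counted ℝ := ⟨x * y, 1⟩

/-- Division, one operation. -/
def opDiv (x y : ℝ) : Counted ℝ := ⟨x / y, 1⟩

/-- A two-dimensional array of real numbers. -/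
abbrev Arr := ℕ → ℕ → ℝ

/-- Overwrite the entry `(i, j)` by `v`. -/
def Arr.store (A : Arr) (i j : ℕ) (v : ℝ) : Arr :=
  fun i' j' => if i' = i ∧ j' = j then v else A i' j'

/-- Run `body i` for `i = lo, lo + 1, …, hi - 1`. -/
def forRange (lo hi : ℕ) (body : ℕ → Arr → Counted Arr) (A : Arr) : Counted Arr :=
  (List.range' lo (hi - lo)).foldlM (fun A i => body i A) A

/-- Replace the entry `(i, j)` by its difference with the product of entries `(i, s)` and
`(s, j)`. -/
def updateEntry (i s j : ℕ) (A : Arr) : Counted Arr := do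
  let t ← opMul (A i s) (A s j)
  let v ← opSub (A i j) t
  pure (A.store i j v)

/-- Replace the entry `(i, s)` by its quotient by the entry `(s, s)`. -/
def divideEntry (i s : ℕ) (A : Arr) : Counted Arr := do
  let l ← opDiv (A i s) (A s s)
  pure (A.store i s l)

/-- Gaussian elimination, in place and without pivoting, of the diagonal block with rows and
columns `lo, …, hi - 1`, which is assumed to have bandwidth at most `p`. The multipliers are
stored below the diagonal. -/
def bandedLU (p lo hi : ℕ) : Arr → Counted Arr :=
  forRange lo hi fun s =>
    forRange (s + 1) (min hi (s + p + 1)) fun i A => do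
      let A ← divideEntry i s A
      forRange (s + 1) (min hi (s + p + 1)) (fun j => updateEntry i s j) A

/-- Forward substitutions for `L_B X = P`: the unit lower triangular factor `L_B` (bandwidth at
most `p`) is stored in the first `b` rows and columns, and `P` in the columns `b, …, n - 1` of the
first `b` rows, where it is overwritten by `X`. -/
def solveX (p b n : ℕ) : Arr → Counted Arr :=
  forRange b n fun j => forRange 0 b fun i => forRange (i - p) i fun s => updateEntry i s j

/-- Substitutions for `Y U_B = Q`: the upper triangular factor `U_B` (bandwidth at most `p`) is
stored in the first `b` rows and columns, and `Q` in the first `b` columns of the rows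
`b, …, n - 1`, where it is overwritten by `Y`. -/
def solveY (p b n : ℕ) : Arr → Counted Arr :=
  forRange b n fun i => forRange 0 b fun j A => do
    let A ← forRange (j - p) j (fun s => updateEntry i s j) A
    divideEntry i j A

/-- Overwrite the lower right block `S` by `S - Y X`. -/
def formSchur (b n : ℕ) : Arr → Counted Arr :=
  forRange b n fun i => forRange b n fun j => forRange 0 b fun s => updateEntry i s j

/-- The LU factorization of a matrix `[B, P; Q, S]` of size `n` that is banded up to corner blocks
of dimension `p`, where `S` has dimension `k = min p n`: banded LU factorization of `B`, solution
of `L_B X = P` and of `Y U_B = Q`, and (unbanded) LU factorization of `S - Y X`. -/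
def cornerLU (p n : ℕ) (A : Arr) : Counted Arr := do
  let k := min p n
  let b := n - k
  let A ← bandedLU p 0 b A
  let A ← solveX p b n A
  let A ← solveY p b n A
  let A ← formSchur b n A
  bandedLU k b n A

/-- A matrix as an array. -/
def toArr {n : ℕ} (A : Matrix (Fin n) (Fin n) ℝ) : Arr :=
  fun i j => if hij : i < n ∧ j < n then A ⟨i, hij.1⟩ ⟨j, hij.2⟩ else 0

/-- The factorization applied to a matrix. -/
def runLU {n : ℕ} (p : ℕ) (A : Matrix (Fin n) (Fin n) ℝ) : Counted Arr := cornerLU p n (toArr A)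

/-- The unit lower triangular factor that is stored in an array. -/
def lowerFactor (n : ℕ) (A : Arr) : Matrix (Fin n) (Fin n) ℝ :=
  fun i j => if j < i then A i j else if i = j then 1 else 0

/-- The upper triangular factor that is stored in an array. -/
def upperFactor (n : ℕ) (A : Arr) : Matrix (Fin n) (Fin n) ℝ :=
  fun i j => if i ≤ j then A i j else 0

/-- All leading principal minors of order less than `n` are nonzero: no zero pivot is met when
the matrix is factored without pivoting. -/
def HasNonzeroPivots {n : ℕ} (A : Matrix (Fin n) (Fin n) ℝ) : Prop :=
  ∀ q : ℕ, ∀ hq : q < n, (A.submatrix (Fin.castLE hq.le) (Fin.castLE hq.le)).det ≠ 0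

end

/-! Merging moves components only between a cell and its neighbours and never empties or changes a
cell deep inside `Ω`, so a cell whose neighbourhood lies in `Ω` stays regular. Hence every PLG cell
is within distance `7 h` of the boundary. A piecewise `C¹` curve is Lipschitz, so only `O(1 / h)`
cells are that close to it.

If the curves are disjoint and have no cusps, each of them is a homeomorphism of the circle `ℝ / ℤ`
onto its trace whose inverse is Lipschitz (chord-arc condition). Two coupled PLG cells have closest
boundary points at distance `O(h)`, so for small `h` they lie on the same curve, and their
parameters differ by `O(h)` modulo `1`. Only boundedly many cells have parameters in an interval of
length `O(h)`; since the cells are numbered by increasing parameter, the block is banded, and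
coupling across the base point of the circle accounts for the two corners.

Elimination without pivoting computes the Doolittle entries, given by the recursion `luEntry`. The
zeros of the matrix outside its band persist in the factors, so the truncated loops compute the
same entries, at a cost of `O(p ^ 2)` operations per row. -/

namespace Counted

variable {α β : Type}

@[simp] theorem pure_cost (x : α) : (pure x : Counted α).cost = 0 := rfl

@[simp] theorem bind_val (x : Counted α) (f : α → Counted β) : (x >>= f).val = (f x.val).val := rfl

@[simp] theorem bind_cost (x : Counted α) (f : α → Counted β) :
    (x >>= f).cost = x.cost + (f x.val).cost := rfl

end Counted

theorem forRange_of_le {lo hi : ℕ} (h : hi ≤ lo) (body : ℕ → Arr → Counted Arr) (A : Arr) :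
    forRange lo hi body A = pure A := by
  simp [forRange, Nat.sub_eq_zero_of_le h]

theorem forRange_of_lt {lo hi : ℕ} (h : lo < hi) (body : ℕ → Arr → Counted Arr) (A : Arr) :
    forRange lo hi body A = body lo A >>= forRange (lo + 1) hi body := by
  have hsub : hi - lo = hi - (lo + 1) + 1 := by lia
  rw [forRange, hsub, List.range'_succ, List.foldlM_cons]
  rfl

theorem forRange_val {lo hi : ℕ} (hle : lo ≤ hi) {body : ℕ → Arr → Counted Arr} {F : ℕ → Arr}
    (hstep : ∀ q, lo ≤ q → q < hi → (body q (F q)).val = F (q + 1)) :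
    (forRange lo hi body (F lo)).val = F hi := by
  induction hd : hi - lo generalizing lo with
  | zero => rw [forRange_of_le (by lia), hle.antisymm (by lia)]; rfl
  | succ d ih =>
    rw [forRange_of_lt (by lia), Counted.bind_val, hstep lo le_rfl (by lia)]
    exact ih (by lia) (fun q hq => hstep q (by lia)) (by lia)

theorem forRange_forRange_val {a a' c c' : ℕ} (ha : a ≤ a') (hc : c ≤ c')
    {body : ℕ → ℕ → Arr → Counted Arr} {F : ℕ → ℕ → Arr}
    (hstep : ∀ x y, a ≤ x → x < a' → c ≤ y → y < c' → (body x y (F x y)).val = F x (y + 1))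
    (hnext : ∀ x, a ≤ x → x < a' → F x c' = F (x + 1) c) :
    (forRange a a' (fun x => forRange c c' (body x)) (F a c)).val = F a' c :=
  forRange_val (F := (F · c)) ha fun x hx hx' =>
    (forRange_val (F := F x) hc fun y => hstep x y hx hx').trans (hnext x hx hx')

theorem forRange_cost_le {lo hi c : ℕ} {body : ℕ → Arr → Counted Arr}
    (h : ∀ i A, (body i A).cost ≤ c) (A : Arr) :
    (forRange lo hi body A).cost ≤ (hi - lo) * c := by
  induction hd : hi - lo generalizing lo A with
  | zero => rw [forRange_of_le (by lia), Counted.pure_cost, zero_mul]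
  | succ d ih =>
    rw [forRange_of_lt (by lia), Counted.bind_cost, add_one_mul, add_comm]
    exact add_le_add (ih _ (by lia)) (h lo A)

theorem forRange_cost_le_of_sub_le {lo hi c m : ℕ} {body : ℕ → Arr → Counted Arr}
    (hm : hi - lo ≤ m) (h : ∀ i A, (body i A).cost ≤ c) (A : Arr) :
    (forRange lo hi body A).cost ≤ m * c :=
  (forRange_cost_le h A).trans (Nat.mul_le_mul_right c hm)

theorem updateEntry_val (i s j : ℕ) (A : Arr) :
    (updateEntry i s j A).val = A.store i j (A i j - A i s * A s j) := rfl

theorem updateEntry_cost (i s j : ℕ) (A : Arr) : (updateEntry i s j A).cost = 2 := rfl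

theorem divideEntry_val (i s : ℕ) (A : Arr) :
    (divideEntry i s A).val = A.store i s (A i s / A s s) := rfl

theorem divideEntry_cost (i s : ℕ) (A : Arr) : (divideEntry i s A).cost = 1 := rfl

section Cost

variable {p lo hi b n : ℕ}

theorem bandedLU_cost_le {m : ℕ} (hm : hi - lo ≤ m) (A : Arr) :
    (bandedLU p lo hi A).cost ≤ m * (p * (1 + p * 2)) := by
  refine forRange_cost_le_of_sub_le hm (fun s => forRange_cost_le_of_sub_le (by lia) ?_) A
  intro i A
  rw [Counted.bind_cost, divideEntry_cost]
  gcongr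
  exact forRange_cost_le_of_sub_le (by lia) (fun j A => (updateEntry_cost i s j A).le) _

theorem solveX_cost_le (hb : b ≤ n) (hp : n - b ≤ p) (A : Arr) :
    (solveX p b n A).cost ≤ p * (n * (p * 2)) :=
  forRange_cost_le_of_sub_le hp (fun j => forRange_cost_le_of_sub_le (by lia) fun i =>
    forRange_cost_le_of_sub_le (by lia) fun s A => (updateEntry_cost i s j A).le) A

theorem solveY_cost_le (hb : b ≤ n) (hp : n - b ≤ p) (A : Arr) :
    (solveY p b n A).cost ≤ p * (n * (p * 2 + 1)) := by
  refine forRange_cost_le_of_sub_le hp (fun i => forRange_cost_le_of_sub_le (by lia) ?_) A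
  intro j A
  rw [Counted.bind_cost, divideEntry_cost]
  gcongr
  exact forRange_cost_le_of_sub_le (by lia) (fun s A => (updateEntry_cost i s j A).le) _

theorem formSchur_cost_le (hb : b ≤ n) (hp : n - b ≤ p) (A : Arr) :
    (formSchur b n A).cost ≤ p * (p * (n * 2)) :=
  forRange_cost_le_of_sub_le hp (fun i => forRange_cost_le_of_sub_le hp fun j =>
    forRange_cost_le_of_sub_le (by lia) fun s A => (updateEntry_cost i s j A).le) A

theorem cornerLU_cost_le (p n : ℕ) (A : Arr) :
    (cornerLU p n A).cost ≤ (10 * p ^ 2 + 3 * p) * n := by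
  have hb : n - min p n ≤ n := Nat.sub_le _ _
  have hp : n - (n - min p n) ≤ p := by lia
  have hSchur (A : Arr) :
      (bandedLU (min p n) (n - min p n) n A).cost ≤ n * (p * (1 + p * 2)) :=
    (bandedLU_cost_le (m := n) (Nat.sub_le _ _) A).trans (by gcongr <;> exact min_le_left p n)
  simp only [cornerLU, Counted.bind_cost]
  refine (add_le_add (bandedLU_cost_le (m := n) (by lia) _) <|
    add_le_add (solveX_cost_le hb hp _) <| add_le_add (solveY_cost_le hb hp _) <|
      add_le_add (formSchur_cost_le hb hp _) (hSchur _)).trans_eq ?_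
  ring

end Cost

/-- The entries of the Doolittle factors of the array `A`, the multipliers below the diagonal. -/
noncomputable def luEntry (A : Arr) (i j : ℕ) : ℝ :=
  (A i j - ∑ s : Fin (min i j), luEntry A i s * luEntry A s j) /
    if j < i then luEntry A j j else 1
termination_by i + j
decreasing_by all_goals lia

/-- The entry `(i, j)` of the Schur complement of the leading block of size `q` in `A`. -/
noncomputable def schurEntry (A : Arr) (q i j : ℕ) : ℝ :=
  A i j - ∑ s ∈ Finset.range q, luEntry A i s * luEntry A s j

/-- The content of the array `A` after `q` stages of in-place Gaussian elimination. -/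
noncomputable def partialLU (A : Arr) (q : ℕ) : Arr := fun i j =>
  if min i j < q then luEntry A i j else schurEntry A q i j

section Doolittle

variable (A : Arr) {q s i j : ℕ}

theorem luEntry_of_le (h : i ≤ j) : luEntry A i j = schurEntry A i i j := by
  rw [luEntry, if_neg h.not_gt, min_eq_left h, div_one, schurEntry, Finset.sum_range]

theorem luEntry_of_lt (h : j < i) : luEntry A i j = schurEntry A j i j / luEntry A j j := by
  rw [luEntry, if_pos h, min_eq_right h.le, schurEntry, Finset.sum_range]

theorem schurEntry_succ (q i j : ℕ) :
    schurEntry A (q + 1) i j = schurEntry A q i j - luEntry A i q * luEntry A q j := by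
  rw [schurEntry, schurEntry, Finset.sum_range_succ, sub_add_eq_sub_sub]

theorem partialLU_zero : partialLU A 0 = A := by
  ext i j
  simp [partialLU, schurEntry]

theorem partialLU_of_left_lt (h : i < q) : partialLU A q i j = luEntry A i j :=
  if_pos (min_lt_of_left_lt h)

theorem partialLU_of_right_lt (h : j < q) : partialLU A q i j = luEntry A i j :=
  if_pos (min_lt_of_right_lt h)

theorem partialLU_of_le (hi : q ≤ i) (hj : q ≤ j) : partialLU A q i j = schurEntry A q i j :=
  if_neg (le_min hi hj).not_gt

theorem partialLU_succ_of_left_le (h : i ≤ s) : partialLU A (s + 1) i j = partialLU A s i j := by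
  rw [partialLU_of_left_lt A (Nat.lt_succ_of_le h)]
  rcases lt_or_ge i s with his | his
  · rw [partialLU_of_left_lt A his]
  obtain rfl := h.antisymm his
  rcases lt_or_ge j i with hj | hj
  · rw [partialLU_of_right_lt A hj]
  · rw [partialLU_of_le A le_rfl hj, luEntry_of_le A hj]

theorem partialLU_succ_of_right_lt (h : j < s) : partialLU A (s + 1) i j = partialLU A s i j := by
  rw [partialLU_of_right_lt A h, partialLU_of_right_lt A (h.trans s.lt_succ_self)]

theorem partialLU_succ_pivot_column (h : s < i) :
    partialLU A (s + 1) i s = partialLU A s i s / partialLU A s s s := by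
  rw [partialLU_of_right_lt A s.lt_succ_self, partialLU_of_le A h.le le_rfl,
    partialLU_of_le A le_rfl le_rfl, luEntry_of_lt A h, ← luEntry_of_le A le_rfl]

theorem partialLU_succ_of_lt_of_lt (hi : s < i) (hj : s < j) :
    partialLU A (s + 1) i j =
      partialLU A s i j - partialLU A s i s / partialLU A s s s * partialLU A s s j := by
  rw [← partialLU_succ_pivot_column A hi, partialLU_of_right_lt A s.lt_succ_self,
    partialLU_of_le A hi hj, partialLU_of_le A hi.le hj.le, partialLU_of_le A le_rfl hj.le,
    schurEntry_succ, ← luEntry_of_le A hj.le]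

end Doolittle

theorem luEntry_eq_zero_of_banded {A : Arr} {p b : ℕ}
    (h : ∀ i j, i < b → j < b → (i + p < j ∨ j + p < i) → A i j = 0) (i j : ℕ) (hi : i < b)
    (hj : j < b) (hij : i + p < j ∨ j + p < i) : luEntry A i j = 0 := by
  induction hm : min i j using Nat.strong_induction_on generalizing i j with
  | _ m ih =>
    rw [luEntry, h i j hi hj hij, Finset.sum_eq_zero, sub_zero, zero_div]
    intro s _
    rcases hij with hij | hij
    · rw [ih s (by lia) s j (by lia) hj (by lia) (by lia), mul_zero]
    · rw [ih s (by lia) i s hi (by lia) (by lia) (by lia), zero_mul]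

theorem sum_range_succ_min_mul_luEntry {A : Arr} {i j : ℕ} (hpiv : j < i → luEntry A j j ≠ 0) :
    ∑ s ∈ Finset.range (min i j + 1), (if s < i then luEntry A i s else 1) * luEntry A s j =
      A i j := by
  have hsum : ∑ s ∈ Finset.range (min i j), (if s < i then luEntry A i s else 1) * luEntry A s j =
      A i j - schurEntry A (min i j) i j := by
    rw [schurEntry, sub_sub_cancel]
    refine Finset.sum_congr rfl fun s hs => ?_
    rw [if_pos (lt_min_iff.1 (Finset.mem_range.1 hs)).1]
  rw [Finset.sum_range_succ, hsum]
  rcases lt_or_ge j i with h | h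
  · rw [min_eq_right h.le, if_pos h, luEntry_of_lt A h, div_mul_cancel₀ _ (hpiv h),
      sub_add_cancel]
  · rw [min_eq_left h, if_neg i.lt_irrefl, one_mul, luEntry_of_le A h, sub_add_cancel]

theorem lowerFactor_mul_upperFactor {A : Arr} {q : ℕ}
    (hpiv : ∀ j, j + 1 < q → luEntry A j j ≠ 0) :
    lowerFactor q (luEntry A) * upperFactor q (luEntry A) =
      Matrix.of fun i j : Fin q => A i j := by
  ext i j
  rw [Matrix.of_apply, ← sum_range_succ_min_mul_luEntry (i := i) (j := j)
    fun hji => hpiv j (by lia), Matrix.mul_apply]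
  have hprod (s : Fin q) : lowerFactor q (luEntry A) i s * upperFactor q (luEntry A) s j =
      if (s : ℕ) ∈ Finset.range (min (i : ℕ) j + 1) then
        (if (s : ℕ) < i then luEntry A i s else 1) * luEntry A s j else 0 := by
    simp only [lowerFactor, upperFactor, Finset.mem_range, Fin.lt_def, Fin.le_def, Fin.ext_iff]
    split_ifs <;> lia
  simp only [hprod]
  rw [Fin.sum_univ_eq_sum_range (fun s => if s ∈ Finset.range (min (i : ℕ) j + 1) then
    (if s < i then luEntry A i s else 1) * luEntry A s j else 0), ← Finset.sum_filter]
  congr 1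
  ext s
  simp only [Finset.mem_filter, Finset.mem_range]
  lia

theorem det_lowerFactor (n : ℕ) (A : Arr) : (lowerFactor n A).det = 1 := by
  rw [Matrix.det_of_isLowerTriangular]
  · simp [lowerFactor]
  · intro i j (hij : i < j)
    rw [lowerFactor, if_neg hij.not_gt, if_neg hij.ne]

theorem det_upperFactor (n : ℕ) (A : Arr) : (upperFactor n A).det = ∏ i : Fin n, A i i := by
  rw [Matrix.det_of_isUpperTriangular]
  · simp [upperFactor]
  · intro i j (hij : j < i)
    rw [upperFactor, if_neg hij.not_ge]

theorem toArr_apply {n : ℕ} (A : Matrix (Fin n) (Fin n) ℝ) (i j : Fin n) :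
    toArr A i j = A i j :=
  dif_pos ⟨i.2, j.2⟩

theorem HasNonzeroPivots.luEntry_ne_zero {n : ℕ} {A : Matrix (Fin n) (Fin n) ℝ}
    (h : HasNonzeroPivots A) (j : ℕ) (hj : j + 1 < n) : luEntry (toArr A) j j ≠ 0 := by
  induction j using Nat.strong_induction_on with
  | _ j ih =>
    have hfactor : A.submatrix (Fin.castLE hj.le) (Fin.castLE hj.le) =
        lowerFactor (j + 1) (luEntry (toArr A)) * upperFactor (j + 1) (luEntry (toArr A)) := by
      rw [lowerFactor_mul_upperFactor fun i hi => ih i (by lia) (by lia)]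
      ext i k
      exact (toArr_apply A (Fin.castLE hj.le i) (Fin.castLE hj.le k)).symm
    have hdet := h (j + 1) hj
    rw [hfactor, Matrix.det_mul, det_lowerFactor, one_mul, det_upperFactor] at hdet
    exact Finset.prod_ne_zero_iff.1 hdet (Fin.last j) (Finset.mem_univ _)

open Classical in
/-- The array `A` with its entries in the region `P` replaced by those of `V`. It describes the
content of the memory in the course of an in-place computation of `V`. -/
noncomputable def Arr.overwrite (A : Arr) (P : ℕ → ℕ → Prop) (V : Arr) : Arr := fun i j =>
  if P i j then V i j else A i j

section Overwrite

variable {A V : Arr} {P Q : ℕ → ℕ → Prop} {i j : ℕ}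

theorem Arr.store_apply (A : Arr) (i j : ℕ) (v : ℝ) (i' j' : ℕ) :
    A.store i j v i' j' = if i' = i ∧ j' = j then v else A i' j' := rfl

theorem Arr.store_self (A : Arr) (i j : ℕ) : A.store i j (A i j) = A := by
  ext i' j'
  rw [Arr.store_apply]
  split_ifs with h
  · rw [h.1, h.2]
  · rfl

theorem Arr.store_store (A : Arr) (i j : ℕ) (v w : ℝ) :
    (A.store i j v).store i j w = A.store i j w := by
  ext i' j'
  simp only [Arr.store_apply]
  split_ifs <;> rfl

theorem Arr.overwrite_of_pos (h : P i j) : A.overwrite P V i j = V i j := if_pos h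

theorem Arr.overwrite_of_neg (h : ¬P i j) : A.overwrite P V i j = A i j := if_neg h

theorem Arr.overwrite_of_forall_not (h : ∀ i j, ¬P i j) : A.overwrite P V = A := by
  ext i j
  exact Arr.overwrite_of_neg (h i j)

theorem Arr.overwrite_congr (h : ∀ i j, P i j ↔ Q i j) : A.overwrite P V = A.overwrite Q V := by
  obtain rfl : P = Q := funext₂ fun i j => propext (h i j)
  rfl

theorem Arr.store_overwrite (h : ∀ i' j', Q i' j' ↔ P i' j' ∨ i' = i ∧ j' = j) :
    (A.overwrite P V).store i j (V i j) = A.overwrite Q V := by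
  ext i' j'
  rw [Arr.store_apply]
  split_ifs with hij
  · rw [Arr.overwrite_of_pos ((h _ _).2 (.inr hij)), hij.1, hij.2]
  · by_cases hP : P i' j'
    · rw [Arr.overwrite_of_pos hP, Arr.overwrite_of_pos ((h _ _).2 (.inl hP))]
    · rw [Arr.overwrite_of_neg hP, Arr.overwrite_of_neg fun hQ => ((h _ _).1 hQ).elim hP hij]

end Overwrite

theorem forRange_updateEntry_val {lo hi i j : ℕ} (hle : lo ≤ hi) (hi' : hi ≤ i) (hj' : hi ≤ j)
    (A : Arr) :
    (forRange lo hi (fun s => updateEntry i s j) A).val =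
      A.store i j (A i j - ∑ s ∈ Finset.Ico lo hi, A i s * A s j) := by
  have hA : A = A.store i j (A i j - ∑ s ∈ Finset.Ico lo lo, A i s * A s j) := by
    rw [Finset.Ico_self, Finset.sum_empty, sub_zero, Arr.store_self]
  conv_lhs => rw [hA]
  refine forRange_val (F := fun q => A.store i j (A i j - ∑ s ∈ Finset.Ico lo q, A i s * A s j))
    hle fun s hlo hhi => ?_
  ext i' j'
  have hsi : s ≠ i := by lia
  have hsj : s ≠ j := by lia
  simp only [updateEntry_val, Arr.store_apply, Finset.sum_Ico_succ_top hlo, hsi, hsj, and_true,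
    and_false, and_self, if_true, if_false, sub_add_eq_sub_sub]
  split_ifs <;> rfl

theorem forRange_eliminateRow_val {s i e : ℕ} (hs : s < e) (hsi : s ≠ i) (A V : Arr)
    (hpivot : V i s = A i s / A s s)
    (hupdate : ∀ j, s < j → j < e → V i j = A i j - A i s / A s s * A s j) :
    (divideEntry i s A >>= forRange (s + 1) e fun j => updateEntry i s j).val =
      A.overwrite (fun i' j' => i' = i ∧ s ≤ j' ∧ j' < e) V := by
  have hstart : (divideEntry i s A).val =
      A.overwrite (fun i' j' => i' = i ∧ s ≤ j' ∧ j' < s + 1) V := by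
    have hempty : A.overwrite (fun _ _ => False) V = A := Arr.overwrite_of_forall_not fun _ _ => id
    rw [divideEntry_val, ← hpivot]
    conv_lhs => rw [← hempty]
    exact Arr.store_overwrite fun i' j' => by lia
  rw [Counted.bind_val, hstart]
  refine forRange_val (F := fun q => A.overwrite (fun i' j' => i' = i ∧ s ≤ j' ∧ j' < q) V) hs
    fun j hsj hje => ?_
  rw [updateEntry_val, Arr.overwrite_of_neg (by lia), Arr.overwrite_of_pos (by lia),
    Arr.overwrite_of_neg fun h => hsi h.1, hpivot, ← hupdate j hsj hje]
  exact Arr.store_overwrite fun i' j' => by lia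

theorem forRange_eliminateColumn_val {s e : ℕ} (hs : s < e) (A V : Arr)
    (hpivot : ∀ i, s < i → i < e → V i s = A i s / A s s)
    (hupdate : ∀ i j, s < i → i < e → s < j → j < e → V i j = A i j - A i s / A s s * A s j) :
    (forRange (s + 1) e (fun i A =>
      divideEntry i s A >>= forRange (s + 1) e fun j => updateEntry i s j) A).val =
      A.overwrite (fun i j => s < i ∧ i < e ∧ s ≤ j ∧ j < e) V := by
  conv_lhs => rw [← Arr.overwrite_of_forall_not (A := A) (V := V)
    (P := fun i j => s < i ∧ i < s + 1 ∧ s ≤ j ∧ j < e) fun i j => by lia]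
  refine forRange_val (F := fun q => A.overwrite (fun i j => s < i ∧ i < q ∧ s ≤ j ∧ j < e) V) hs
    fun i hsi hie => ?_
  rw [forRange_eliminateRow_val hs (by lia) _ V]
  · ext i' j'
    simp only [Arr.overwrite]
    split_ifs <;> first | rfl | lia
  · rw [Arr.overwrite_of_neg (by lia), Arr.overwrite_of_neg (by lia), hpivot i hsi hie]
  · intro j hsj hje
    rw [Arr.overwrite_of_neg (by lia), Arr.overwrite_of_neg (by lia),
      Arr.overwrite_of_neg (by lia), Arr.overwrite_of_neg (by lia), hupdate i j hsi hie hsj hje]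

theorem partialLU_succ_of_multiplier_eq_zero {A : Arr} {s i j : ℕ} (hpiv : luEntry A s s ≠ 0)
    (hsi : s < i) (h : luEntry A i s = 0) : partialLU A (s + 1) i j = partialLU A s i j := by
  rcases lt_trichotomy j s with hj | rfl | hj
  · exact partialLU_succ_of_right_lt A hj
  · rw [partialLU_of_right_lt A j.lt_succ_self, partialLU_of_le A hsi.le le_rfl, h]
    rw [luEntry_of_lt A hsi, div_eq_zero_iff] at h
    exact (h.resolve_right hpiv).symm
  · rw [partialLU_of_le A hsi hj, partialLU_of_le A hsi.le hj.le, schurEntry_succ, h, zero_mul,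
      sub_zero]

theorem partialLU_succ_of_pivotRow_eq_zero {A : Arr} {s i j : ℕ} (hsj : s < j)
    (h : luEntry A s j = 0) : partialLU A (s + 1) i j = partialLU A s i j := by
  rcases le_or_gt i s with hi | hi
  · exact partialLU_succ_of_left_le A hi
  · rw [partialLU_of_le A hi hsj, partialLU_of_le A hi.le hsj.le, schurEntry_succ, h, mul_zero,
      sub_zero]

section BandedElimination

variable {A B : Arr} {p lo hi b n : ℕ}

theorem partialLU_succ_of_outside_band {s i j : ℕ}
    (hband : ∀ i j, lo ≤ i → i < hi → lo ≤ j → j < hi → (i + p < j ∨ j + p < i) →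
      luEntry A i j = 0)
    (hpiv : ∀ j, j + 1 < hi → luEntry A j j ≠ 0)
    (hs : lo ≤ s) (hi' : i < hi) (hj' : j < hi)
    (hout : ¬(s < i ∧ i < s + p + 1 ∧ s ≤ j ∧ j < s + p + 1)) :
    partialLU A (s + 1) i j = partialLU A s i j := by
  rcases le_or_gt i s with hi | hi
  · exact partialLU_succ_of_left_le A hi
  rcases lt_or_ge j s with hj | hj
  · exact partialLU_succ_of_right_lt A hj
  rcases lt_or_ge i (s + p + 1) with hip | hip
  · exact partialLU_succ_of_pivotRow_eq_zero (by lia)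
      (hband s j hs (by lia) (by lia) hj' (by lia))
  · exact partialLU_succ_of_multiplier_eq_zero (hpiv s (by lia)) hi
      (hband i s (by lia) hi' hs (by lia) (by lia))

theorem bandedLU_val (hle : lo ≤ hi)
    (hB : ∀ i j, lo ≤ i → i < hi → lo ≤ j → j < hi → B i j = partialLU A lo i j)
    (hband : ∀ i j, lo ≤ i → i < hi → lo ≤ j → j < hi → (i + p < j ∨ j + p < i) →
      luEntry A i j = 0)
    (hpiv : ∀ j, j + 1 < hi → luEntry A j j ≠ 0) :
    (bandedLU p lo hi B).val =
      B.overwrite (fun i j => lo ≤ i ∧ i < hi ∧ lo ≤ j ∧ j < hi) (luEntry A) := by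
  have hend : B.overwrite (fun i j => lo ≤ i ∧ i < hi ∧ lo ≤ j ∧ j < hi) (partialLU A hi) =
      B.overwrite (fun i j => lo ≤ i ∧ i < hi ∧ lo ≤ j ∧ j < hi) (luEntry A) := by
    ext i j
    simp only [Arr.overwrite]
    split_ifs with h
    · exact partialLU_of_left_lt A h.2.1
    · rfl
  have hstart : B = B.overwrite (fun i j => lo ≤ i ∧ i < hi ∧ lo ≤ j ∧ j < hi)
      (partialLU A lo) := by
    ext i j
    by_cases h : lo ≤ i ∧ i < hi ∧ lo ≤ j ∧ j < hi
    · rw [Arr.overwrite_of_pos h, hB i j h.1 h.2.1 h.2.2.1 h.2.2.2]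
    · rw [Arr.overwrite_of_neg h]
  rw [← hend]
  conv_lhs => rw [hstart]
  refine forRange_val (F := fun q => B.overwrite
    (fun i j => lo ≤ i ∧ i < hi ∧ lo ≤ j ∧ j < hi) (partialLU A q)) hle fun s hlos hshi => ?_
  refine (forRange_eliminateColumn_val (by lia) _ (partialLU A (s + 1)) ?_ ?_).trans ?_
  · intro i hsi hi'
    rw [Arr.overwrite_of_pos (by lia), Arr.overwrite_of_pos (by lia),
      partialLU_succ_pivot_column A hsi]
  · intro i j hsi hi' hsj hj'
    rw [Arr.overwrite_of_pos (by lia), Arr.overwrite_of_pos (by lia),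
      Arr.overwrite_of_pos (by lia), Arr.overwrite_of_pos (by lia),
      partialLU_succ_of_lt_of_lt A hsi hsj]
  · ext i j
    simp only [Arr.overwrite]
    split_ifs with hactive hblock hblock
    · rfl
    · lia
    · exact (partialLU_succ_of_outside_band hband hpiv hlos hblock.2.1 hblock.2.2.2 (by lia)).symm
    · rfl

theorem schurEntry_eq_sum_Ico {q i j : ℕ} (hle : lo ≤ q)
    (h : ∀ s < lo, luEntry A i s * luEntry A s j = 0) :
    schurEntry A q i j = A i j - ∑ s ∈ Finset.Ico lo q, luEntry A i s * luEntry A s j := by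
  rw [schurEntry, ← Finset.sum_range_add_sum_Ico _ hle, Finset.sum_eq_zero (s := Finset.range lo)
    (fun s hs => h s (Finset.mem_range.1 hs)), zero_add]

theorem solveX_val (hbn : b ≤ n)
    (hF : ∀ i j, i < b → j < b → B i j = luEntry A i j)
    (hP : ∀ i j, i < b → b ≤ j → j < n → B i j = A i j)
    (hband : ∀ i j, i < b → j < b → (i + p < j ∨ j + p < i) → luEntry A i j = 0) :
    (solveX p b n B).val = B.overwrite (fun i j => i < b ∧ b ≤ j ∧ j < n) (luEntry A) := by
  let F (y x : ℕ) : Arr :=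
    B.overwrite (fun i j => i < b ∧ b ≤ j ∧ (j < y ∨ j = y ∧ i < x)) (luEntry A)
  have hstart : F b 0 = B := Arr.overwrite_of_forall_not fun i j => by lia
  have hend : F n 0 = B.overwrite (fun i j => i < b ∧ b ≤ j ∧ j < n) (luEntry A) :=
    Arr.overwrite_congr fun i j => by lia
  rw [← hend]
  conv_lhs => rw [← hstart]
  refine forRange_forRange_val hbn (Nat.zero_le b) (fun j i hj hjn _ hi => ?_)
    fun j _ _ => Arr.overwrite_congr fun i' j' => by lia
  have hsum : ∑ s ∈ Finset.Ico (i - p) i, F j i i s * F j i s j =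
      ∑ s ∈ Finset.Ico (i - p) i, luEntry A i s * luEntry A s j := by
    refine Finset.sum_congr rfl fun s hs => ?_
    have hs' := Finset.mem_Ico.1 hs
    have hL : F j i i s = luEntry A i s :=
      (Arr.overwrite_of_neg (by lia)).trans (hF i s hi (by lia))
    have hX : F j i s j = luEntry A s j := Arr.overwrite_of_pos (by lia)
    rw [hL, hX]
  have hentry : F j i i j = A i j := (Arr.overwrite_of_neg (by lia)).trans (hP i j hi hj hjn)
  rw [forRange_updateEntry_val (by lia) (by lia) (by lia), hsum, hentry,
    ← schurEntry_eq_sum_Ico (by lia) fun s hs => by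
      rw [hband i s hi (by lia) (by lia), zero_mul], ← luEntry_of_le A (by lia)]
  exact Arr.store_overwrite fun i' j' => by lia

theorem solveY_val (hbn : b ≤ n)
    (hF : ∀ i j, i < b → j < b → B i j = luEntry A i j)
    (hQ : ∀ i j, b ≤ i → i < n → j < b → B i j = A i j)
    (hband : ∀ i j, i < b → j < b → (i + p < j ∨ j + p < i) → luEntry A i j = 0) :
    (solveY p b n B).val = B.overwrite (fun i j => b ≤ i ∧ i < n ∧ j < b) (luEntry A) := by
  let F (x y : ℕ) : Arr :=
    B.overwrite (fun i j => b ≤ i ∧ j < b ∧ (i < x ∨ i = x ∧ j < y)) (luEntry A)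
  have hstart : F b 0 = B := Arr.overwrite_of_forall_not fun i j => by lia
  have hend : F n 0 = B.overwrite (fun i j => b ≤ i ∧ i < n ∧ j < b) (luEntry A) :=
    Arr.overwrite_congr fun i j => by lia
  rw [← hend]
  conv_lhs => rw [← hstart]
  refine forRange_forRange_val hbn (Nat.zero_le b) (fun i j hi hin _ hj => ?_)
    fun i _ _ => Arr.overwrite_congr fun i' j' => by lia
  have hsum : ∑ s ∈ Finset.Ico (j - p) j, F i j i s * F i j s j =
      ∑ s ∈ Finset.Ico (j - p) j, luEntry A i s * luEntry A s j := by
    refine Finset.sum_congr rfl fun s hs => ?_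
    have hs' := Finset.mem_Ico.1 hs
    have hY : F i j i s = luEntry A i s := Arr.overwrite_of_pos (by lia)
    have hU : F i j s j = luEntry A s j :=
      (Arr.overwrite_of_neg (by lia)).trans (hF s j (by lia) hj)
    rw [hY, hU]
  have hentry : F i j i j = A i j := (Arr.overwrite_of_neg (by lia)).trans (hQ i j hi hin hj)
  have hpivot (v : ℝ) : (F i j).store i j v j j = luEntry A j j :=
    (if_neg (by lia)).trans ((Arr.overwrite_of_neg (by lia)).trans (hF j j hj hj))
  have hstored (v : ℝ) : (F i j).store i j v i j = v := if_pos ⟨rfl, rfl⟩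
  rw [Counted.bind_val, forRange_updateEntry_val (by lia) (by lia) (by lia), divideEntry_val, hsum,
    hentry, ← schurEntry_eq_sum_Ico (by lia) fun s hs => by
      rw [hband s j (by lia) hj (by lia), mul_zero], hpivot, hstored,
    ← luEntry_of_lt A (by lia), Arr.store_store]
  exact Arr.store_overwrite fun i' j' => by lia

theorem formSchur_val (hbn : b ≤ n)
    (hX : ∀ i j, i < b → b ≤ j → j < n → B i j = luEntry A i j)
    (hY : ∀ i j, b ≤ i → i < n → j < b → B i j = luEntry A i j)
    (hS : ∀ i j, b ≤ i → i < n → b ≤ j → j < n → B i j = A i j) :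
    (formSchur b n B).val =
      B.overwrite (fun i j => b ≤ i ∧ i < n ∧ b ≤ j ∧ j < n) (schurEntry A b) := by
  let F (x y : ℕ) : Arr := B.overwrite
    (fun i j => b ≤ i ∧ b ≤ j ∧ j < n ∧ (i < x ∨ i = x ∧ j < y)) (schurEntry A b)
  have hstart : F b b = B := Arr.overwrite_of_forall_not fun i j => by lia
  have hend : F n b =
      B.overwrite (fun i j => b ≤ i ∧ i < n ∧ b ≤ j ∧ j < n) (schurEntry A b) :=
    Arr.overwrite_congr fun i j => by lia
  rw [← hend]
  conv_lhs => rw [← hstart]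
  refine forRange_forRange_val hbn hbn (fun i j hi hin hj hjn => ?_)
    fun i _ _ => Arr.overwrite_congr fun i' j' => by lia
  have hsum : ∑ s ∈ Finset.Ico 0 b, F i j i s * F i j s j =
      ∑ s ∈ Finset.Ico 0 b, luEntry A i s * luEntry A s j := by
    refine Finset.sum_congr rfl fun s hs => ?_
    have hs' := Finset.mem_Ico.1 hs
    have hY' : F i j i s = luEntry A i s :=
      (Arr.overwrite_of_neg (by lia)).trans (hY i s hi hin (by lia))
    have hX' : F i j s j = luEntry A s j :=
      (Arr.overwrite_of_neg (by lia)).trans (hX s j (by lia) hj hjn)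
    rw [hY', hX']
  have hentry : F i j i j = A i j :=
    (Arr.overwrite_of_neg (by lia)).trans (hS i j hi hin hj hjn)
  rw [forRange_updateEntry_val (by lia) (by lia) (by lia), hsum, hentry,
    ← schurEntry_eq_sum_Ico (by lia) fun s hs => by lia]
  exact Arr.store_overwrite fun i' j' => by lia

theorem cornerLU_val
    (hband : ∀ i j, i < n - min p n → j < n - min p n → (i + p < j ∨ j + p < i) → A i j = 0)
    (hpiv : ∀ j, j + 1 < n → luEntry A j j ≠ 0) (i j : ℕ) (hi : i < n) (hj : j < n) :
    (cornerLU p n A).val i j = luEntry A i j := by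
  have hband' := luEntry_eq_zero_of_banded hband
  simp only [cornerLU, Counted.bind_val]
  set b := n - min p n
  have hbn : b ≤ n := Nat.sub_le _ _
  rw [bandedLU_val (A := A) (B := A) (Nat.zero_le b) (by simp only [partialLU_zero, implies_true])
      (fun i j _ hi _ hj => hband' i j hi hj) fun j hj => hpiv j (by lia),
    solveX_val (A := A) hbn ?_ ?_ hband', solveY_val (A := A) hbn ?_ ?_ hband',
    formSchur_val (A := A) hbn ?_ ?_ ?_, bandedLU_val (A := A) hbn ?_ ?_ hpiv]
  rotate_left
  · intro i j hi _ hj _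
    rw [Arr.overwrite_of_pos (by lia), partialLU_of_le A hi hj]
  · lia
  all_goals
    intros
    simp only [Arr.overwrite]
    split_ifs <;> first | rfl | lia

end BandedElimination

theorem IsBandedUpToCorners.lowerFactor_mul_upperFactor {n p : ℕ}
    {A : Matrix (Fin n) (Fin n) ℝ} (hA : IsBandedUpToCorners p A) (hpiv : HasNonzeroPivots A) :
    lowerFactor n (runLU p A).val * upperFactor n (runLU p A).val = A := by
  have hband (i j : ℕ) (hi : i < n - min p n) (hj : j < n - min p n)
      (hij : i + p < j ∨ j + p < i) : toArr A i j = 0 := by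
    by_contra h0
    have := hA ⟨i, by lia⟩ ⟨j, by lia⟩ (by rwa [← toArr_apply A])
    lia
  have hval (i j : Fin n) : (runLU p A).val i j = luEntry (toArr A) i j :=
    cornerLU_val hband hpiv.luEntry_ne_zero i j i.2 j.2
  have hlower : lowerFactor n (runLU p A).val = lowerFactor n (luEntry (toArr A)) := by
    ext i j
    simp only [lowerFactor, hval]
  have hupper : upperFactor n (runLU p A).val = upperFactor n (luEntry (toArr A)) := by
    ext i j
    simp only [upperFactor, hval]
  rw [hlower, hupper, _root_.lowerFactor_mul_upperFactor hpiv.luEntry_ne_zero]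
  ext i j
  exact toArr_apply A i j

/-! ### The merging algorithm -/

theorem regUnion_eq (S T : Set Plane) : regUnion S T = interior (closure (S ∪ T)) := by
  rw [regUnion, exteriorSet, exteriorSet, interior_compl (s := S ∪ T), compl_compl]

theorem isOpen_regUnion (S T : Set Plane) : IsOpen (regUnion S T) := isOpen_interior

theorem subset_regUnion_left {S T : Set Plane} (hS : IsOpen S) : S ⊆ regUnion S T := by
  rw [regUnion_eq]
  exact interior_maximal (subset_union_left.trans subset_closure) hS

theorem regUnion_subset {Ω S T : Set Plane} (hΩ : interior (closure Ω) = Ω) (hS : S ⊆ Ω)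
    (hT : T ⊆ Ω) : regUnion S T ⊆ Ω := by
  rw [regUnion_eq, ← hΩ]
  exact interior_mono (closure_mono (union_subset hS hT))

theorem gridCell_eq_preimage_pi (h : ℝ) (i : Idx) :
    gridCell h i = (WithLp.ofLp : Plane → Fin 2 → ℝ) ⁻¹'
      univ.pi fun d => Ioo ((i d : ℝ) * h) (((i d : ℝ) + 1) * h) := by
  ext x
  simp only [gridCell, mem_ofPred_eq, mem_preimage, mem_univ_pi, mem_Ioo]

theorem isOpen_gridCell (h : ℝ) (i : Idx) : IsOpen (gridCell h i) := by
  rw [gridCell_eq_preimage_pi]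
  exact (isOpen_set_pi finite_univ fun _ _ => isOpen_Ioo).preimage (PiLp.continuous_ofLp 2 _)

theorem convex_gridCell (h : ℝ) (i : Idx) : Convex ℝ (gridCell h i) := by
  rw [gridCell_eq_preimage_pi]
  exact (convex_pi fun _ _ => convex_Ioo _ _).linear_preimage
    (WithLp.linearEquiv 2 ℝ (Fin 2 → ℝ)).toLinearMap

theorem volume_real_gridCell {h : ℝ} (hh : 0 ≤ h) (i : Idx) :
    volume.real (gridCell h i) = h ^ 2 := by
  rw [gridCell_eq_preimage_pi, Measure.real,
    (PiLp.volume_preserving_ofLp (Fin 2)).measure_preimage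
      (MeasurableSet.univ_pi fun _ => measurableSet_Ioo).nullMeasurableSet, Real.volume_pi_Ioo,
    Fin.prod_univ_two, ENNReal.toReal_mul, ENNReal.toReal_ofReal (by linarith),
    ENNReal.toReal_ofReal (by linarith)]
  ring

theorem cellCenter_mem_gridCell {h : ℝ} (hh : 0 < h) (i : Idx) :
    cellCenter h i ∈ gridCell h i := fun d => by
  simp only [cellCenter]
  constructor <;> nlinarith

section Merging

variable {Ω : Set Plane} {h ε : ℝ} {σ τ : CutState} {i j : Idx} {K L : Set Plane}
  {q : Idx × Set Plane}

theorem mem_or_eq_regUnion_of_mem_mergeInto (hL : L ∈ mergeInto σ i K q j) :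
    L ∈ σ j ∨ j = q.1 ∧ L = regUnion q.2 K := by
  unfold mergeInto at hL
  split_ifs at hL with hj
  · exact hL.symm.imp And.left fun hL => ⟨hj, hL⟩
  · exact .inl hL.1
  · exact .inl hL

theorem mergeInto_target (σ : CutState) (i : Idx) (K : Set Plane) (q : Idx × Set Plane) :
    mergeInto σ i K q q.1 = insert (regUnion q.2 K) (σ q.1 \ {q.2}) :=
  if_pos rfl

theorem mergeInto_of_ne (hq : j ≠ q.1) (hi : j ≠ i) : mergeInto σ i K q j = σ j :=
  (if_neg hq).trans (if_neg hi)

/-- The index `j` is interior: its cell lies in `Ω`, and so do those neighboring cells that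
meet `Ω`. Since only components of cells not contained in `Ω` are ever merged into a neighbor,
the merging algorithm leaves such a cell alone. -/
def IsInteriorIdx (Ω : Set Plane) (h : ℝ) (j : Idx) : Prop :=
  gridCell h j ⊆ Ω ∧
    ∀ k : Idx, ∑ d, |j d - k d| = 1 → (gridCell h k ∩ Ω).Nonempty → gridCell h k ⊆ Ω

/-- The properties of the initial state that every step of the merging algorithm preserves. -/
structure MergeInvariant (Ω : Set Plane) (h : ℝ) (σ : CutState) : Prop where
  meets : ∀ i, (σ i).Nonempty → (gridCell h i ∩ Ω).Nonempty
  isOpen : ∀ i, ∀ K ∈ σ i, IsOpen K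
  subset : ∀ i, ∀ K ∈ σ i, K ⊆ Ω
  full : ∀ i, gridCell h i ⊆ Ω → ∃ S, σ i = {S} ∧ gridCell h i ⊆ S
  unchanged : ∀ i, IsInteriorIdx Ω h i → σ i = {gridCell h i}

theorem initialState_of_gridCell_subset (hh : 0 < h) (hi : gridCell h i ⊆ Ω) :
    initialState Ω h i = {gridCell h i} := by
  have hcomponent {x : Plane} (hx : x ∈ gridCell h i) :
      connectedComponentIn (gridCell h i) x = gridCell h i :=
    (convex_gridCell h i).isPreconnected.connectedComponentIn hx
  ext K
  simp only [initialState, inter_eq_left.2 hi, mem_ofPred_eq, mem_singleton_iff]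
  constructor
  · rintro ⟨x, hx, rfl⟩
    exact hcomponent hx
  · rintro rfl
    exact ⟨_, cellCenter_mem_gridCell hh i, (hcomponent (cellCenter_mem_gridCell hh i)).symm⟩

theorem mergeInvariant_initialState (hh : 0 < h) (hΩ : IsOpen Ω) :
    MergeInvariant Ω h (initialState Ω h) where
  meets := by
    rintro i ⟨_, x, hx, -⟩
    exact ⟨x, hx⟩
  isOpen := by
    rintro i K ⟨x, -, rfl⟩
    exact ((isOpen_gridCell h i).inter hΩ).connectedComponentIn
  subset := by
    rintro i K ⟨x, -, rfl⟩
    exact (connectedComponentIn_subset _ _).trans inter_subset_right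
  full := fun i hi => ⟨_, initialState_of_gridCell_subset hh hi, subset_rfl⟩
  unchanged := fun i hi => initialState_of_gridCell_subset hh hi.1

namespace MergeInvariant

theorem mergeInto (hσ : MergeInvariant Ω h σ) (hΩ : interior (closure Ω) = Ω) (hK : K ∈ σ i)
    (hi : ¬gridCell h i ⊆ Ω) (hq : q ∈ neighborComponents σ i K) :
    MergeInvariant Ω h (mergeInto σ i K q) where
  meets := by
    rintro j ⟨L, hL⟩
    obtain hL | ⟨rfl, -⟩ := mem_or_eq_regUnion_of_mem_mergeInto hL
    · exact hσ.meets j ⟨L, hL⟩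
    · exact hσ.meets q.1 ⟨q.2, hq.1⟩
  isOpen := by
    intro j L hL
    obtain hL | ⟨-, rfl⟩ := mem_or_eq_regUnion_of_mem_mergeInto hL
    · exact hσ.isOpen j L hL
    · exact isOpen_regUnion _ _
  subset := by
    intro j L hL
    obtain hL | ⟨-, rfl⟩ := mem_or_eq_regUnion_of_mem_mergeInto hL
    · exact hσ.subset j L hL
    · exact regUnion_subset hΩ (hσ.subset _ _ hq.1) (hσ.subset _ _ hK)
  full := by
    intro j hj
    obtain ⟨S, hS, hjS⟩ := hσ.full j hj
    have hji : j ≠ i := by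
      rintro rfl
      exact hi hj
    by_cases hjq : j = q.1
    · subst hjq
      obtain rfl : q.2 = S := by simpa only [hS, mem_singleton_iff] using hq.1
      refine ⟨regUnion q.2 K, ?_, hjS.trans (subset_regUnion_left (hσ.isOpen _ _ hq.1))⟩
      rw [mergeInto_target, hS, sdiff_self, insert_empty_eq]
    · exact ⟨S, by rw [mergeInto_of_ne hjq hji, hS], hjS⟩
  unchanged := by
    intro j hj
    have hji : j ≠ i := by
      rintro rfl
      exact hi hj.1
    have hjq : j ≠ q.1 := by
      rintro rfl
      exact hi (hj.2 i hq.2.1 (hσ.meets i ⟨K, hK⟩))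
    rw [mergeInto_of_ne hjq hji, hσ.unchanged j hj]

theorem mergeStep (hσ : MergeInvariant Ω h σ) (hΩ : interior (closure Ω) = Ω)
    (hbdd : Bornology.IsBounded Ω) (hh : 0 ≤ h) (hε : ε ≤ 1) (hστ : MergeStep h ε σ τ) :
    MergeInvariant Ω h τ := by
  cases hστ with
  | split i K M q hK hM hKM _ hq =>
    refine hσ.mergeInto hΩ hK (fun hi => ?_) hq.1
    obtain ⟨S, hS, -⟩ := hσ.full i hi
    rw [hS] at hK hM
    exact hKM (hK.trans hM.symm)
  | small i K q _ hK hsmall hq =>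
    refine hσ.mergeInto hΩ hK (fun hi => ?_) hq.1
    obtain ⟨S, hS, hiS⟩ := hσ.full i hi
    obtain rfl : K = S := by simpa only [hS, mem_singleton_iff] using hK
    have hvolume : volume.real (gridCell h i) ≤ volume.real K :=
      measureReal_mono hiS (hbdd.subset (hσ.subset i K hK)).measure_lt_top.ne
    rw [volume_real_gridCell hh] at hvolume
    nlinarith [sq_nonneg h]

theorem of_reflTransGen (hΩ : interior (closure Ω) = Ω) (hbdd : Bornology.IsBounded Ω)
    (hh : 0 < h) (hε : ε ≤ 1)
    (hσ : Relation.ReflTransGen (MergeStep h ε) (initialState Ω h) σ) : MergeInvariant Ω h σ := by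
  induction hσ with
  | refl => exact mergeInvariant_initialState hh (hΩ ▸ isOpen_interior)
  | tail _ hστ ih => exact ih.mergeStep hΩ hbdd hh.le hε hστ

end MergeInvariant

end Merging

/-! ### PLG cells are close to the boundary -/

theorem Plane.dist_le_two_mul {x y : Plane} {a : ℝ} (h : ∀ d, |x d - y d| ≤ a) :
    dist x y ≤ 2 * a := by
  have ha : 0 ≤ a := (abs_nonneg _).trans (h 0)
  rw [EuclideanSpace.dist_eq, Fin.sum_univ_two, Real.dist_eq, Real.dist_eq]
  refine Real.sqrt_le_iff.2 ⟨by positivity, ?_⟩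
  nlinarith [pow_le_pow_left₀ (abs_nonneg _) (h 0) 2, pow_le_pow_left₀ (abs_nonneg _) (h 1) 2]

theorem dist_cellCenter_le_of_mem_gridCell {h : ℝ} (hh : 0 < h) {i k : Idx} {n : ℤ}
    (hki : ∀ d, |k d - i d| ≤ n) {x : Plane} (hx : x ∈ gridCell h k) :
    dist x (cellCenter h i) ≤ (2 * n + 1) * h := by
  refine (Plane.dist_le_two_mul fun d => ?_).trans_eq
    (by ring : 2 * (((n : ℝ) + 1 / 2) * h) = (2 * n + 1) * h)
  have hki' : |(k d : ℝ) - i d| ≤ n := by exact_mod_cast hki d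
  obtain ⟨hlow, hhigh⟩ := hx d
  rw [abs_le] at hki' ⊢
  simp only [cellCenter]
  constructor <;> nlinarith

theorem abs_sub_le_two_of_mem_symmetricStencil {b : ℝ} {i j : Idx} (hj : j ∈ symmetricStencil b i)
    (d : Fin 2) : |j d - i d| ≤ 2 := by
  rcases hj with ⟨-, e, m, hm, rfl⟩ | ⟨-, m₁, m₂, hm₁, hm₂, rfl⟩
  · fin_cases d <;> fin_cases e <;> simp [unitIdx, hm]
  · fin_cases d <;> simp [unitIdx, hm₁, hm₂]

theorem inter_frontier_nonempty_of_isPreconnected {X : Type*} [TopologicalSpace X] {s u : Set X}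
    (hs : IsPreconnected s) (hu : IsOpen u) (hsu : (s ∩ u).Nonempty) (hsu' : ¬s ⊆ u) :
    (s ∩ frontier u).Nonempty := by
  by_contra hempty
  have hdisj : Disjoint (frontier u) s :=
    (disjoint_iff_inter_eq_empty.2 (not_nonempty_iff_eq_empty.1 hempty)).symm
  have : PreconnectedSpace s := Subtype.preconnectedSpace hs
  rcases isClopen_iff.1 (isClopen_preimage_val hu hdisj) with h | h
  · exact hsu.ne_empty (Subtype.preimage_coe_eq_empty.1 h)
  · exact hsu' (by rwa [preimage_eq_univ_iff, Subtype.range_coe] at h)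

theorem exists_mem_frontier_dist_cellCenter_le {Ω : Set Plane} (hΩ : IsOpen Ω) {h : ℝ}
    (hh : 0 < h) {i k : Idx} {n : ℤ} (hki : ∀ d, |k d - i d| ≤ n)
    (hi : (gridCell h i ∩ Ω).Nonempty) (hk : ¬gridCell h k ⊆ Ω) :
    ∃ x ∈ frontier Ω, dist (cellCenter h i) x ≤ (2 * n + 1) * h := by
  have hn : 0 ≤ n := (abs_nonneg _).trans (hki 0)
  have hball {j : Idx} (hj : ∀ d, |j d - i d| ≤ n) :
      gridCell h j ⊆ Metric.closedBall (cellCenter h i) ((2 * n + 1) * h) :=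
    fun x hx => dist_cellCenter_le_of_mem_gridCell hh hj hx
  obtain ⟨x, hx, hxΩ⟩ := inter_frontier_nonempty_of_isPreconnected
    (convex_closedBall (cellCenter h i) ((2 * n + 1) * h)).isPreconnected hΩ
    (hi.mono (inter_subset_inter_left Ω (hball fun d => by simpa using hn)))
    fun hsub => hk ((hball hki).trans hsub)
  exact ⟨x, hxΩ, Metric.mem_closedBall'.1 hx⟩

theorem exists_not_gridCell_subset_of_mem_plgCells {Ω : Set Plane} {E : EllipticProblem}
    {h : ℝ} {σ : CutState} (hσ : MergeInvariant Ω h σ) {i : Idx}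
    (hi : i ∈ plgCells Ω E h fun j => ⋃₀ σ j) :
    ∃ k : Idx, (∀ d, |k d - i d| ≤ 3) ∧ ¬gridCell h k ⊆ Ω := by
  -- The stencil reaches to distance `2`; the third unit leads from a stencil cell to a neighbor.
  obtain ⟨-, hstencil⟩ := hi
  push Not at hstencil
  obtain ⟨j, hj, hirregular, -⟩ := hstencil
  have hji := abs_sub_le_two_of_mem_symmetricStencil hj
  by_cases hjΩ : gridCell h j ⊆ Ω
  · have hinterior : ¬IsInteriorIdx Ω h j := fun hint => hirregular <| by
      rw [IsRegularCell, hσ.unchanged j hint, sUnion_singleton]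
    simp only [IsInteriorIdx, hjΩ, true_and] at hinterior
    push Not at hinterior
    obtain ⟨k, hjk, -, hkΩ⟩ := hinterior
    refine ⟨k, fun d => ?_, hkΩ⟩
    have hjk' : |j d - k d| ≤ 1 := hjk ▸ Finset.single_le_sum (f := fun d => |j d - k d|)
      (fun _ _ => abs_nonneg _) (Finset.mem_univ d)
    linarith [abs_sub_le (k d) (j d) (i d), abs_sub_comm (j d) (k d), hji d]
  · exact ⟨j, fun d => (hji d).trans (by norm_num), hjΩ⟩

theorem exists_mem_frontier_dist_le_of_mem_plgCells {Ω : Set Plane}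
    (hΩ : interior (closure Ω) = Ω) (hbdd : Bornology.IsBounded Ω) {E : EllipticProblem}
    {h ε : ℝ} (hh : 0 < h) (hε : ε ≤ 1) {𝒞 : Idx → Set Plane} (h𝒞 : IsMergedCutCells Ω h ε 𝒞)
    {i : Idx} (hi : i ∈ plgCells Ω E h 𝒞) :
    ∃ x ∈ frontier Ω, dist (cellCenter h i) x ≤ 7 * h := by
  obtain ⟨σ, hσ, -, -, h𝒞σ⟩ := h𝒞
  obtain rfl : 𝒞 = fun i => ⋃₀ σ i := funext h𝒞σ
  have hinv := MergeInvariant.of_reflTransGen hΩ hbdd hh hε hσ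
  obtain ⟨k, hki, hk⟩ := exists_not_gridCell_subset_of_mem_plgCells hinv hi
  obtain ⟨x, K, hK, -⟩ := hi.1
  have hopen : IsOpen Ω := hΩ ▸ isOpen_interior
  have hfrontier :=
    exists_mem_frontier_dist_cellCenter_le hopen hh hki (hinv.meets i ⟨K, hK⟩) hk
  norm_num at hfrontier
  exact hfrontier

/-! ### Piecewise continuously differentiable Jordan curves -/

theorem exists_castSucc_not_succ {n : ℕ} {P : Fin (n + 1) → Prop} (hzero : P 0)
    (hlast : ¬P (Fin.last n)) : ∃ k : Fin n, P k.castSucc ∧ ¬P k.succ := by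
  by_contra! h
  exact hlast (Fin.induction hzero h (Fin.last n))

section ChordArc

variable {V : Type*} [NormedAddCommGroup V] [InnerProductSpace ℝ V]

theorem exists_monotoneOn_of_hasStrictDerivAt {f : ℝ → ℝ} {f' a : ℝ} (hf : HasStrictDerivAt f f' a)
    (hf' : 0 < f') : ∃ U ∈ 𝓝 a, MonotoneOn f U := by
  have hbound := hf.isLittleO.bound hf'
  rw [nhds_prod_eq] at hbound
  obtain ⟨U, hU, hbound⟩ := mem_prod_self_iff.1 hbound
  refine ⟨U, hU, fun s hs t ht hst => ?_⟩
  have habs : |f t - f s - (t - s) * f'| ≤ f' * |t - s| := hbound (mk_mem_prod ht hs)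
  rw [abs_of_nonneg (sub_nonneg.2 hst)] at habs
  linarith [(abs_le.1 habs).1]

theorem exists_monotoneOn_of_eventuallyEq {f g₁ g₂ : ℝ → ℝ} {d₁ d₂ a : ℝ}
    (hfg₁ : f =ᶠ[𝓝[≤] a] g₁) (hfg₂ : f =ᶠ[𝓝[≥] a] g₂) (hg₁ : HasStrictDerivAt g₁ d₁ a)
    (hg₂ : HasStrictDerivAt g₂ d₂ a) (hd₁ : 0 < d₁) (hd₂ : 0 < d₂) :
    ∃ U ∈ 𝓝 a, MonotoneOn f U := by
  obtain ⟨U₁, hU₁, hmono₁⟩ := exists_monotoneOn_of_hasStrictDerivAt hg₁ hd₁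
  obtain ⟨U₂, hU₂, hmono₂⟩ := exists_monotoneOn_of_hasStrictDerivAt hg₂ hd₂
  obtain ⟨l, hl, hl'⟩ := mem_nhdsLE_iff_exists_Icc_subset.1
    (inter_mem hfg₁ (mem_nhdsWithin_of_mem_nhds hU₁))
  obtain ⟨u, hu, hu'⟩ := mem_nhdsGE_iff_exists_Icc_subset.1
    (inter_mem hfg₂ (mem_nhdsWithin_of_mem_nhds hU₂))
  refine ⟨Icc l u, Icc_mem_nhds hl hu, ?_⟩
  rw [← Icc_union_Icc_eq_Icc (le_of_lt hl) (le_of_lt hu)]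
  refine MonotoneOn.union_right ?_ ?_ (isGreatest_Icc (le_of_lt hl)) (isLeast_Icc (le_of_lt hu))
  · exact (hmono₁.mono fun s hs => (hl' hs).2).congr fun s hs => (hl' hs).1.symm
  · exact (hmono₂.mono fun s hs => (hu' hs).2).congr fun s hs => (hu' hs).1.symm

theorem exists_inner_pos_of_not_sameRay_neg {v w : V} (hv : v ≠ 0) (hw : w ≠ 0)
    (h : ¬SameRay ℝ v (-w)) : ∃ u : V, 0 < inner ℝ u v ∧ 0 < inner ℝ u w := by
  have hinner : -(‖v‖ * ‖w‖) < inner ℝ v w := by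
    have hne : inner ℝ v (-w) ≠ ‖v‖ * ‖-w‖ := fun heq =>
      h (sameRay_iff_norm_smul_eq.2 (inner_eq_norm_mul_iff_real.1 heq).symm)
    have hlt := (real_inner_le_norm v (-w)).lt_of_ne hne
    rw [inner_neg_right, norm_neg] at hlt
    linarith
  have hv' := norm_pos_iff.2 hv
  have hw' := norm_pos_iff.2 hw
  refine ⟨‖w‖ • v + ‖v‖ • w, ?_, ?_⟩
  · rw [inner_add_left, real_inner_smul_left, real_inner_smul_left, real_inner_self_eq_norm_sq,
      real_inner_comm]
    nlinarith
  · rw [inner_add_left, real_inner_smul_left, real_inner_smul_left, real_inner_self_eq_norm_sq]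
    nlinarith

theorem exists_dist_le_mul_dist_of_not_cusp {F p q : ℝ → V} {v w : V} {a : ℝ}
    (hFp : F =ᶠ[𝓝[≤] a] p) (hFq : F =ᶠ[𝓝[≥] a] q) (hp : HasStrictDerivAt p v a)
    (hq : HasStrictDerivAt q w a) (hv : v ≠ 0) (hw : w ≠ 0) (hvw : ¬SameRay ℝ v (-w)) :
    ∃ K : NNReal, ∃ U ∈ 𝓝 a, ∀ s ∈ U, ∀ t ∈ U, dist s t ≤ K * dist (F s) (F t) := by
  obtain ⟨u, huv, huw⟩ := exists_inner_pos_of_not_sameRay_neg hv hw hvw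
  obtain ⟨c, hc, hcvw⟩ := exists_between (lt_min huv huw)
  rw [lt_min_iff] at hcvw
  have hderiv {g : ℝ → V} {g' : V} (hg : HasStrictDerivAt g g' a) :
      HasStrictDerivAt (fun s => inner ℝ u (g s) - c * s) (inner ℝ u g' - c) a := by
    have hinner := (innerSL ℝ u).hasStrictFDerivAt.comp_hasStrictDerivAt a hg
    exact hinner.sub (by simpa using (hasStrictDerivAt_id a).const_mul c)
  obtain ⟨U, hU, hmono⟩ := exists_monotoneOn_of_eventuallyEq
    (f := fun s => inner ℝ u (F s) - c * s)
    (hFp.mono fun s hs => by simp only [hs]) (hFq.mono fun s hs => by simp only [hs])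
    (hderiv hp) (hderiv hq) (sub_pos.2 hcvw.1) (sub_pos.2 hcvw.2)
  refine ⟨(‖u‖ / c).toNNReal, U, hU, fun s hs t ht => ?_⟩
  wlog hst : s ≤ t generalizing s t
  · rw [dist_comm, dist_comm (F s)]
    exact this t ht s hs (le_of_not_ge hst)
  have hspeed : c * (t - s) ≤ ‖u‖ * ‖F t - F s‖ :=
    calc c * (t - s) ≤ inner ℝ u (F t - F s) := by
          rw [inner_sub_right]
          linarith [hmono hs ht hst]
      _ ≤ ‖u‖ * ‖F t - F s‖ := real_inner_le_norm _ _
  rw [Real.coe_toNNReal _ (by positivity), dist_comm, Real.dist_eq,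
    abs_of_nonneg (sub_nonneg.2 hst), dist_comm, dist_eq_norm, div_mul_eq_mul_div, le_div_iff₀ hc]
  linarith

end ChordArc

theorem exists_antilipschitzWith_of_locally {X Y : Type*} [MetricSpace X] [CompactSpace X]
    [MetricSpace Y] {f : X → Y} (hf : Continuous f) (hinj : Function.Injective f)
    (hloc : ∀ x, ∃ K : NNReal, ∃ U ∈ 𝓝 x, ∀ y ∈ U, ∀ z ∈ U, dist y z ≤ K * dist (f y) (f z)) :
    ∃ K, AntilipschitzWith K f := by
  suffices h : ∃ K : NNReal, ∀ z ∈ (univ : Set (X × X)),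
      dist z.1 z.2 ≤ K * dist (f z.1) (f z.2) by
    obtain ⟨K, hK⟩ := h
    exact ⟨K, AntilipschitzWith.of_le_mul_dist fun x y => hK (x, y) trivial⟩
  refine isCompact_univ.induction_on
    (p := fun S : Set (X × X) => ∃ K : NNReal, ∀ z ∈ S, dist z.1 z.2 ≤ K * dist (f z.1) (f z.2))
    ⟨0, fun z hz => hz.elim⟩ (fun S T hST ⟨K, hK⟩ => ⟨K, fun z hz => hK z (hST hz)⟩) ?_ ?_
  · rintro S T ⟨K, hK⟩ ⟨L, hL⟩
    refine ⟨max K L, fun z hz => hz.elim (fun hz => (hK z hz).trans ?_)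
      fun hz => (hL z hz).trans ?_⟩
    · gcongr
      exact le_max_left K L
    · gcongr
      exact le_max_right K L
  · rintro ⟨x, y⟩ -
    rw [nhdsWithin_univ]
    rcases eq_or_ne x y with rfl | hxy
    · obtain ⟨K, U, hU, hK⟩ := hloc x
      exact ⟨U ×ˢ U, prod_mem_nhds hU hU, K, fun z hz => hK z.1 hz.1 z.2 hz.2⟩
    · have hpos : 0 < dist (f x) (f y) := dist_pos.2 (hinj.ne hxy)
      have hcont : ContinuousAt (fun z : X × X => dist z.1 z.2 / dist (f z.1) (f z.2)) (x, y) :=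
        ContinuousAt.div (by fun_prop) (by fun_prop) hpos.ne'
      have hcont' : ContinuousAt (fun z : X × X => dist (f z.1) (f z.2)) (x, y) := by fun_prop
      refine ⟨_, (hcont.eventually_lt_const (lt_add_one _)).and (hcont'.eventually_const_lt hpos),
        (dist x y / dist (f x) (f y) + 1).toNNReal, fun z hz => ?_⟩
      rw [← div_le_iff₀ hz.2]
      exact hz.1.le.trans (Real.le_coe_toNNReal _)

namespace JordanCurve

variable (γ : JordanCurve)

theorem exists_mem_Ico_knot {t : ℝ} (ht : t ∈ Ico (0 : ℝ) 1) :
    ∃ k : Fin γ.pieces, t ∈ Ico (γ.knot k.castSucc) (γ.knot k.succ) := by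
  obtain ⟨k, hk, hk'⟩ := exists_castSucc_not_succ (P := fun k => γ.knot k ≤ t)
    (γ.knot_zero.trans_le ht.1) (γ.knot_last ▸ ht.2.not_ge)
  exact ⟨k, hk, not_le.1 hk'⟩

theorem exists_mem_Ioc_knot {t : ℝ} (ht : t ∈ Ioc (0 : ℝ) 1) :
    ∃ k : Fin γ.pieces, t ∈ Ioc (γ.knot k.castSucc) (γ.knot k.succ) := by
  obtain ⟨k, hk, hk'⟩ := exists_castSucc_not_succ (P := fun k => γ.knot k < t)
    (γ.knot_zero.trans_lt ht.1) (γ.knot_last ▸ ht.2.not_gt)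
  exact ⟨k, hk, not_lt.1 hk'⟩

theorem hasStrictDerivAt_piece (k : Fin γ.pieces) (t : ℝ) :
    HasStrictDerivAt (γ.piece k) (deriv (γ.piece k) t) t :=
  (γ.piece_contDiff k).contDiffAt.hasStrictDerivAt one_ne_zero

variable {γ}

theorem eventuallyEq_piece_right {k : Fin γ.pieces} {t : ℝ}
    (ht : t ∈ Ico (γ.knot k.castSucc) (γ.knot k.succ)) : γ.toFun =ᶠ[𝓝[≥] t] γ.piece k := by
  filter_upwards [Icc_mem_nhdsGE ht.2] with s hs
  exact γ.eq_piece k s ⟨ht.1.trans hs.1, hs.2⟩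

theorem eventuallyEq_piece_left {k : Fin γ.pieces} {t : ℝ}
    (ht : t ∈ Ioc (γ.knot k.castSucc) (γ.knot k.succ)) : γ.toFun =ᶠ[𝓝[≤] t] γ.piece k := by
  filter_upwards [Icc_mem_nhdsLE ht.1] with s hs
  exact γ.eq_piece k s ⟨hs.1, hs.2.trans ht.2⟩

theorem hasDerivWithinAt_Ici {k : Fin γ.pieces} {t : ℝ}
    (ht : t ∈ Ico (γ.knot k.castSucc) (γ.knot k.succ)) :
    HasDerivWithinAt γ.toFun (deriv (γ.piece k) t) (Ici t) t :=
  (γ.hasStrictDerivAt_piece k t).hasDerivAt.hasDerivWithinAt.congr_of_eventuallyEq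
    (eventuallyEq_piece_right ht) (γ.eq_piece k t ⟨ht.1, ht.2.le⟩)

theorem hasDerivWithinAt_Iic {k : Fin γ.pieces} {t : ℝ}
    (ht : t ∈ Ioc (γ.knot k.castSucc) (γ.knot k.succ)) :
    HasDerivWithinAt γ.toFun (deriv (γ.piece k) t) (Iic t) t :=
  (γ.hasStrictDerivAt_piece k t).hasDerivAt.hasDerivWithinAt.congr_of_eventuallyEq
    (eventuallyEq_piece_left ht) (γ.eq_piece k t ⟨ht.1.le, ht.2⟩)

variable (γ)

theorem continuousOn_toFun : ContinuousOn γ.toFun (Icc 0 1) := by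
  intro t ht
  have hleft : ContinuousWithinAt γ.toFun (Icc 0 t) t := by
    rcases ht.1.eq_or_lt with rfl | hpos
    · simpa only [Icc_self] using continuousWithinAt_singleton
    · obtain ⟨k, hk⟩ := γ.exists_mem_Ioc_knot ⟨hpos, ht.2⟩
      exact (hasDerivWithinAt_Iic hk).continuousWithinAt.mono Icc_subset_Iic_self
  have hright : ContinuousWithinAt γ.toFun (Icc t 1) t := by
    rcases ht.2.eq_or_lt with rfl | hlt
    · simpa only [Icc_self] using continuousWithinAt_singleton
    · obtain ⟨k, hk⟩ := γ.exists_mem_Ico_knot ⟨ht.1, hlt⟩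
      exact (hasDerivWithinAt_Ici hk).continuousWithinAt.mono Icc_subset_Ici_self
  rw [← Icc_union_Icc_eq_Icc ht.1 ht.2]
  exact hleft.union hright

theorem isCompact_trace : IsCompact γ.trace :=
  isCompact_Icc.image_of_continuousOn γ.continuousOn_toFun

theorem exists_norm_deriv_piece_le :
    ∃ L : NNReal, ∀ k, ∀ t ∈ Icc (0 : ℝ) 1, ‖deriv (γ.piece k) t‖ ≤ L := by
  have hcont (k) : Continuous (deriv (γ.piece k)) :=
    (γ.piece_contDiff k).continuous_deriv le_rfl
  choose B hB using fun k => isCompact_Icc.exists_bound_of_continuousOn (hcont k).continuousOn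
  refine ⟨Finset.univ.sup fun k => (B k).toNNReal, fun k t ht => ?_⟩
  calc ‖deriv (γ.piece k) t‖ ≤ (B k).toNNReal := (hB k t ht).trans (Real.le_coe_toNNReal _)
    _ ≤ (Finset.univ.sup fun k => (B k).toNNReal : NNReal) := by
      exact_mod_cast Finset.le_sup (f := fun k => (B k).toNNReal) (Finset.mem_univ k)

theorem exists_lipschitzOnWith : ∃ L : NNReal, LipschitzOnWith L γ.toFun (Icc 0 1) := by
  obtain ⟨L, hL⟩ := γ.exists_norm_deriv_piece_le
  have hderiv : ∀ t ∈ Ico (0 : ℝ) 1, ∃ v, HasDerivWithinAt γ.toFun v (Ici t) t ∧ ‖v‖ ≤ L := by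
    intro t ht
    obtain ⟨k, hk⟩ := γ.exists_mem_Ico_knot ht
    exact ⟨_, hasDerivWithinAt_Ici hk, hL k t (Ico_subset_Icc_self ht)⟩
  choose! v hv hvL using hderiv
  refine ⟨L, LipschitzOnWith.of_dist_le_mul fun s hs t ht => ?_⟩
  wlog hst : s ≤ t generalizing s t
  · rw [dist_comm, dist_comm s]
    exact this t ht s hs (le_of_not_ge hst)
  have hsub : Ico s t ⊆ Ico 0 1 := Ico_subset_Ico hs.1 ht.2
  have := norm_image_sub_le_of_norm_deriv_right_le_segment
    (γ.continuousOn_toFun.mono (Icc_subset_Icc hs.1 ht.2)) (fun x hx => hv x (hsub hx))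
    (fun x hx => hvL x (hsub hx)) t ⟨hst, le_rfl⟩
  rwa [dist_comm, dist_eq_norm, dist_comm, Real.dist_eq, abs_of_nonneg (sub_nonneg.2 hst)]

/-- The curve as a map on the circle `ℝ / ℤ`, on which its base point is no longer special. -/
noncomputable def loop : UnitAddCircle → Plane := AddCircle.liftIco 1 0 γ.toFun

theorem loop_coe {t : ℝ} (ht : t ∈ Icc (0 : ℝ) 1) : γ.loop t = γ.toFun t := by
  rcases ht.2.eq_or_lt with rfl | hlt
  · have hone : ((1 : ℝ) : UnitAddCircle) = (0 : ℝ) := by simp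
    rw [hone, loop, AddCircle.liftIco_zero_coe_apply ⟨le_rfl, one_pos⟩, γ.closed]
  · exact AddCircle.liftIco_zero_coe_apply ⟨ht.1, hlt⟩

theorem loop_coe_eq_piece {k : Fin γ.pieces} {t : ℝ}
    (ht : t ∈ Icc (γ.knot k.castSucc) (γ.knot k.succ)) : γ.loop t = γ.piece k t := by
  have hmono := γ.knot_strictMono.monotone
  have ht' : t ∈ Icc (0 : ℝ) 1 :=
    ⟨γ.knot_zero ▸ (hmono (Fin.zero_le _)).trans ht.1,
      γ.knot_last ▸ ht.2.trans (hmono (Fin.le_last _))⟩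
  rw [γ.loop_coe ht', γ.eq_piece k t ht]

theorem continuous_loop : Continuous γ.loop :=
  AddCircle.liftIco_zero_continuous γ.closed γ.continuousOn_toFun

theorem injective_loop : Function.Injective γ.loop := by
  have hsurj (x : UnitAddCircle) : ∃ t ∈ Ico (0 : ℝ) 1, (t : UnitAddCircle) = x := by
    have := (AddCircle.coe_image_Ico_eq (1 : ℝ) 0).symm ▸ mem_univ x
    rwa [zero_add] at this
  intro x y hxy
  obtain ⟨s, hs, rfl⟩ := hsurj x
  obtain ⟨t, ht, rfl⟩ := hsurj y
  rw [γ.loop_coe (Ico_subset_Icc_self hs), γ.loop_coe (Ico_subset_Icc_self ht)] at hxy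
  rw [γ.injOn hs ht hxy]

variable {γ}

theorem NoCusp.not_sameRay_deriv_piece (hγ : γ.NoCusp) {s t : ℝ} (hs : s ∈ Ioc 0 1)
    (ht : t ∈ Ico 0 1) (hst : (s : UnitAddCircle) = t) {j k : Fin γ.pieces}
    (hj : s ∈ Ioc (γ.knot j.castSucc) (γ.knot j.succ))
    (hk : t ∈ Ico (γ.knot k.castSucc) (γ.knot k.succ)) :
    ¬SameRay ℝ (deriv (γ.piece j) s) (-deriv (γ.piece k) t) := by
  rw [← (hasDerivWithinAt_Iic hj).derivWithin (uniqueDiffWithinAt_Iic s),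
    ← (hasDerivWithinAt_Ici hk).derivWithin (uniqueDiffWithinAt_Ici t)]
  have heq {s : ℝ} (hs : s ∈ Ico 0 1) (hst : (s : UnitAddCircle) = t) : s = t :=
    (AddCircle.coe_eq_coe_iff_of_mem_Ico (a := 0) (by rwa [zero_add]) (by rwa [zero_add])).1 hst
  rcases hs.2.eq_or_lt with rfl | hlt
  · obtain rfl : 0 = t := heq ⟨le_rfl, one_pos⟩ (hst ▸ (AddCircle.coe_period (1 : ℝ)).symm)
    exact hγ.2
  · obtain rfl := heq ⟨hs.1.le, hlt⟩ hst
    exact hγ.1 s ⟨hs.1, hlt⟩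

theorem NoCusp.exists_dist_le_mul_dist_loop (hγ : γ.NoCusp) (x : UnitAddCircle) :
    ∃ K : NNReal, ∃ U ∈ 𝓝 x, ∀ y ∈ U, ∀ z ∈ U, dist y z ≤ K * dist (γ.loop y) (γ.loop z) := by
  obtain ⟨s, hs, rfl⟩ := (AddCircle.coe_image_Ioc_eq (1 : ℝ) 0).symm ▸ mem_univ x
  obtain ⟨t, ht, hts⟩ := (AddCircle.coe_image_Ico_eq (1 : ℝ) 0).symm ▸ mem_univ (s : UnitAddCircle)
  rw [zero_add] at hs ht
  obtain ⟨j, hj⟩ := γ.exists_mem_Ioc_knot hs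
  obtain ⟨k, hk⟩ := γ.exists_mem_Ico_knot ht
  have hleft : (fun u : ℝ => γ.loop u) =ᶠ[𝓝[≤] s] γ.piece j := by
    filter_upwards [Icc_mem_nhdsLE hj.1] with u hu
    exact γ.loop_coe_eq_piece ⟨hu.1, hu.2.trans hj.2⟩
  have hright : (fun u : ℝ => γ.loop u) =ᶠ[𝓝[≥] s] fun u => γ.piece k (u + (t - s)) := by
    filter_upwards [Icc_mem_nhdsGE (lt_add_of_pos_right s (sub_pos.2 hk.2))] with u hu
    have hshift : ((u + (t - s) : ℝ) : UnitAddCircle) = u := by simp [hts]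
    rw [← hshift]
    exact γ.loop_coe_eq_piece ⟨by linarith [hu.1, hk.1], by linarith [hu.2]⟩
  have hderiv : HasStrictDerivAt (fun u => γ.piece k (u + (t - s))) (deriv (γ.piece k) t) s := by
    rw [← one_smul ℝ (deriv (γ.piece k) t)]
    exact (γ.hasStrictDerivAt_piece k t).scomp_of_eq s
      ((hasStrictDerivAt_id s).add_const (t - s)) (by simp)
  obtain ⟨K, U, hU, hK⟩ := exists_dist_le_mul_dist_of_not_cusp hleft hright
    (γ.hasStrictDerivAt_piece j s) hderiv (γ.piece_regular j s (Ioc_subset_Icc_self hj))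
    (γ.piece_regular k t (Ico_subset_Icc_self hk)) (hγ.not_sameRay_deriv_piece hs ht hts.symm hj hk)
  refine ⟨K, _, QuotientAddGroup.isOpenMap_coe.image_mem_nhds hU, ?_⟩
  rintro _ ⟨y, hy, rfl⟩ _ ⟨z, hz, rfl⟩
  refine le_trans ?_ (hK y hy z hz)
  rw [dist_eq_norm, dist_eq_norm, ← QuotientAddGroup.mk_sub]
  exact QuotientAddGroup.norm_mk_le_norm

theorem NoCusp.exists_antilipschitzWith_loop (hγ : γ.NoCusp) :
    ∃ K, AntilipschitzWith K γ.loop :=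
  exists_antilipschitzWith_of_locally γ.continuous_loop γ.injective_loop
    hγ.exists_dist_le_mul_dist_loop

end JordanCurve
/-! ### Counting cells near a curve -/

/-- A box of indices that contains the indices of all cells whose center has distance at most
`ρ * h` from `y`; the number of indices in it is bounded independently of `h`. -/
noncomputable def cellsNear (h ρ : ℝ) (y : Plane) : Finset Idx :=
  Finset.Icc (fun d => ⌈y d / h - 1 / 2 - ρ⌉) (fun d => ⌊y d / h - 1 / 2 + ρ⌋)

theorem card_cellsNear_le (h ρ : ℝ) (y : Plane) :
    (cellsNear h ρ y).card ≤ (⌊2 * ρ⌋₊ + 1) ^ 2 := by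
  have hside (a : ℝ) : (⌊a + ρ⌋ + 1 - ⌈a - ρ⌉).toNat ≤ ⌊2 * ρ⌋₊ + 1 := by
    have hwidth : ⌊a + ρ⌋ - ⌈a - ρ⌉ ≤ ⌊2 * ρ⌋ := by
      rw [Int.le_floor]
      push_cast
      linarith [Int.floor_le (a + ρ), Int.le_ceil (a - ρ)]
    have := Int.self_le_toNat ⌊2 * ρ⌋
    rw [Int.floor_toNat] at this
    lia
  rw [cellsNear, Pi.card_Icc]
  exact (Finset.prod_le_pow_card _ _ _ fun d _ => (Int.card_Icc _ _).trans_le (hside _)).trans_eq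
    (by rw [Finset.card_univ, Fintype.card_fin])

theorem mem_cellsNear {h ρ : ℝ} (hh : 0 < h) {y : Plane} {i : Idx}
    (hi : dist (cellCenter h i) y ≤ ρ * h) : i ∈ cellsNear h ρ y := by
  have hcoord (d : Fin 2) : |(i d : ℝ) - (y d / h - 1 / 2)| ≤ ρ := by
    have hd := (PiLp.dist_apply_le _ _ d).trans hi
    have hscale : cellCenter h i d - y d = ((i d : ℝ) - (y d / h - 1 / 2)) * h := by
      simp only [cellCenter]
      field
    rwa [Real.dist_eq, hscale, abs_mul, abs_of_pos hh, mul_le_mul_iff_left₀ hh] at hd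
  refine Finset.mem_Icc.2 ⟨fun d => Int.ceil_le.2 ?_, fun d => Int.le_floor.2 ?_⟩
  · linarith [(abs_le.1 (hcoord d)).1]
  · linarith [(abs_le.1 (hcoord d)).2]

/-- The indices of the cells whose center has distance at most `ρ * h` from some point of `K`. -/
def cellsAlong (h ρ : ℝ) (K : Set Plane) : Set Idx :=
  {i | ∃ x ∈ K, dist (cellCenter h i) x ≤ ρ * h}

theorem cellsAlong_iUnion {ι : Type*} (h ρ : ℝ) (K : ι → Set Plane) :
    cellsAlong h ρ (⋃ c, K c) = ⋃ c, cellsAlong h ρ (K c) := by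
  ext i
  simp only [cellsAlong, mem_iUnion, mem_ofPred_eq]
  tauto

theorem cellsAlong_image_subset {f : ℝ → Plane} {L : NNReal} (hf : LipschitzOnWith L f (Icc 0 1))
    {h : ℝ} (hh : 0 < h) (ρ : ℝ) :
    cellsAlong h ρ (f '' Icc 0 1) ⊆
      (Finset.range (⌊1 / h⌋₊ + 1)).biUnion fun k => cellsNear h (ρ + L) (f (k * h)) := by
  rintro i ⟨_, ⟨t, ht, rfl⟩, hi⟩
  have hfloor : (⌊t / h⌋₊ : ℝ) * h ≤ t :=
    (le_div_iff₀ hh).1 (Nat.floor_le (div_nonneg ht.1 hh.le))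
  have hfloor' : t < (⌊t / h⌋₊ + 1 : ℝ) * h := (div_lt_iff₀ hh).1 (Nat.lt_floor_add_one _)
  have hnode : dist t (⌊t / h⌋₊ * h) ≤ h := abs_le.2 ⟨by linarith, by linarith⟩
  refine Finset.mem_biUnion.2 ⟨⌊t / h⌋₊, ?_, mem_cellsNear hh ?_⟩
  · rw [Finset.mem_range, Nat.lt_succ_iff]
    gcongr
    exact ht.2
  · calc dist (cellCenter h i) (f (⌊t / h⌋₊ * h))
        ≤ dist (cellCenter h i) (f t) + dist (f t) (f (⌊t / h⌋₊ * h)) := dist_triangle _ _ _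
      _ ≤ ρ * h + L * h := by
        gcongr
        exact (hf.dist_le_mul t ht _ ⟨by positivity, hfloor.trans ht.2⟩).trans (by gcongr)
      _ = (ρ + L) * h := by ring

theorem exists_ncard_cellsAlong_image_le {f : ℝ → Plane} {L : NNReal}
    (hf : LipschitzOnWith L f (Icc 0 1)) (ρ : ℝ) :
    ∃ C : ℝ, ∀ h : ℝ, 0 < h → h ≤ 1 →
      (cellsAlong h ρ (f '' Icc 0 1)).Finite ∧
      ((cellsAlong h ρ (f '' Icc 0 1)).ncard : ℝ) ≤ C / h := by
  refine ⟨2 * ((⌊2 * (ρ + L)⌋₊ + 1) ^ 2 : ℕ), fun h hh hh1 => ?_⟩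
  have hsub := cellsAlong_image_subset hf hh ρ
  have hcard : (cellsAlong h ρ (f '' Icc 0 1)).ncard ≤
      (⌊1 / h⌋₊ + 1) * (⌊2 * (ρ + L)⌋₊ + 1) ^ 2 := by
    refine (ncard_le_ncard hsub (Finset.finite_toSet _)).trans ?_
    rw [ncard_coe_finset]
    exact (Finset.card_biUnion_le_card_mul _ _ _ fun k _ => card_cellsNear_le _ _ _).trans_eq
      (by rw [Finset.card_range])
  have hnodes : (⌊1 / h⌋₊ + 1 : ℝ) ≤ 2 / h := by
    have hone : 1 ≤ 1 / h := (one_le_div hh).2 hh1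
    linarith [Nat.floor_le (zero_le_one.trans hone), add_div 1 1 h]
  refine ⟨(Finset.finite_toSet _).subset hsub, ?_⟩
  calc (_ : ℝ) ≤ (⌊1 / h⌋₊ + 1) * ((⌊2 * (ρ + L)⌋₊ + 1) ^ 2 : ℕ) := by exact_mod_cast hcard
    _ ≤ 2 / h * ((⌊2 * (ρ + L)⌋₊ + 1) ^ 2 : ℕ) := by gcongr
    _ = 2 * ((⌊2 * (ρ + L)⌋₊ + 1) ^ 2 : ℕ) / h := by ring

theorem exists_ncard_cellsAlong_iUnion_trace_le {ι : Type*} [Finite ι] (γ : ι → JordanCurve)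
    (ρ : ℝ) :
    ∃ C : ℝ, ∀ h : ℝ, 0 < h → h ≤ 1 →
      (cellsAlong h ρ (⋃ c, (γ c).trace)).Finite ∧
      ((cellsAlong h ρ (⋃ c, (γ c).trace)).ncard : ℝ) ≤ C / h := by
  cases nonempty_fintype ι
  choose L hL using fun c => (γ c).exists_lipschitzOnWith
  choose C hC using fun c => exists_ncard_cellsAlong_image_le (hL c) ρ
  refine ⟨∑ c, C c, fun h hh hh1 => ?_⟩
  rw [cellsAlong_iUnion, Finset.sum_div]
  refine ⟨finite_iUnion fun c => (hC c h hh hh1).1, ?_⟩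
  calc (_ : ℝ) ≤ ∑ c, ((cellsAlong h ρ (γ c).trace).ncard : ℝ) := by
        exact_mod_cast ncard_iUnion_le_of_fintype _
    _ ≤ ∑ c, C c / h := Finset.sum_le_sum fun c _ => (hC c h hh hh1).2

theorem exists_ncard_plgCells_le {r : ℕ} {Ω : Set Plane} {γ : Fin r → JordanCurve}
    (hΩ : IsDomainWithBoundary Ω γ) :
    ∃ C : ℝ, ∀ (E : EllipticProblem) (ε h : ℝ), ε ≤ 1 → 0 < h → h ≤ 1 →
      ∀ 𝒞 : Idx → Set Plane, IsMergedCutCells Ω h ε 𝒞 →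
        (plgCells Ω E h 𝒞).Finite ∧ ((plgCells Ω E h 𝒞).ncard : ℝ) ≤ C / h := by
  obtain ⟨C, hC⟩ := exists_ncard_cellsAlong_iUnion_trace_le γ 7
  refine ⟨C, fun E ε h hε hh hh1 𝒞 h𝒞 => ?_⟩
  obtain ⟨hfinite, hcard⟩ := hC h hh hh1
  have hsub : plgCells Ω E h 𝒞 ⊆ cellsAlong h 7 (⋃ c, (γ c).trace) := fun i hi =>
    hΩ.frontier_eq ▸
      exists_mem_frontier_dist_le_of_mem_plgCells hΩ.regularOpen hΩ.bounded hh hε h𝒞 hi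
  exact ⟨hfinite.subset hsub, le_trans (by exact_mod_cast ncard_le_ncard hsub hfinite) hcard⟩
/-! ### The structure of the block of the PLG cells -/

theorem exists_pos_lt_dist_of_pairwise_disjoint {ι X : Type*} [Finite ι] [MetricSpace X]
    {K : ι → Set X} (hK : ∀ c, IsCompact (K c))
    (hdisj : Pairwise fun c c' => Disjoint (K c) (K c')) :
    ∃ δ > 0, ∀ c c', c ≠ c' → ∀ x ∈ K c, ∀ y ∈ K c', δ < dist x y := by
  have hsmall : ∀ᶠ δ : ℝ in 𝓝[>] 0, ∀ c c', c ≠ c' → ∀ x ∈ K c, ∀ y ∈ K c', δ < dist x y := by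
    refine eventually_all.2 fun c => eventually_all.2 fun c' => eventually_imp_distrib_left.2 ?_
    intro hne
    obtain ⟨ρ, hρ, hlt⟩ :=
      Metric.exists_pos_forall_lt_edist (hK c) (hK c').isClosed (hdisj hne)
    filter_upwards [Ioc_mem_nhdsGT (NNReal.coe_pos.2 hρ)] with δ hδ x hx y hy
    have := hlt x hx y hy
    rw [edist_nndist, ENNReal.coe_lt_coe] at this
    exact hδ.2.trans_lt (by exact_mod_cast this)
  obtain ⟨δ, hδ, hpos⟩ := (hsmall.and self_mem_nhdsWithin).exists
  exact ⟨δ, hpos, hδ⟩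

theorem sub_le_or_add_one_sub_le_of_dist_coe_le {s t Δ : ℝ}
    (hΔ : dist (s : UnitAddCircle) t ≤ Δ) : t - s ≤ Δ ∨ s + (1 - t) ≤ Δ := by
  rw [dist_comm, dist_eq_norm, ← AddCircle.coe_sub, UnitAddCircle.norm_eq, abs_le] at hΔ
  rcases le_or_gt (round (t - s)) 0 with hround | hround
  · have : (round (t - s) : ℝ) ≤ 0 := by exact_mod_cast hround
    exact Or.inl (by linarith)
  · have : (1 : ℝ) ≤ round (t - s) := by exact_mod_cast hround
    exact Or.inr (by linarith)

theorem isBandedUpToCorners_of_dist_coe_le {n p : ℕ} {A : Matrix (Fin n) (Fin n) ℝ}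
    {θ : Fin n → ℝ} {Δ : ℝ} (hmono : Monotone θ) (hθ : ∀ k, θ k ∈ Icc (0 : ℝ) 1)
    (hcard : ∀ k, (Finset.univ.filter fun m => |θ m - θ k| ≤ Δ).card ≤ p)
    (hA : ∀ k l, A k l ≠ 0 → dist (θ k : UnitAddCircle) (θ l) ≤ Δ) :
    IsBandedUpToCorners p A := by
  have hcard_of_subset (k : Fin n) (S : Finset (Fin n)) (hS : ∀ m ∈ S, |θ m - θ k| ≤ Δ) :
      S.card ≤ p :=
    (Finset.card_le_card fun m hm =>
      Finset.mem_filter.2 ⟨Finset.mem_univ m, hS m hm⟩).trans (hcard k)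
  have hupper (k l : Fin n) (hkl : k ≤ l) (hd : dist (θ k : UnitAddCircle) (θ l) ≤ Δ) :
      (l : ℕ) ≤ k + p ∨ ((k : ℕ) < p ∧ n ≤ l + p) := by
    have hk0 := (hθ k).1
    have hl1 := (hθ l).2
    rcases sub_le_or_add_one_sub_le_of_dist_coe_le hd with hnear | hwrap
    · have hIcc := hcard_of_subset k (Finset.Icc k l) fun m hm => by
        obtain ⟨hkm, hml⟩ := Finset.mem_Icc.1 hm
        exact abs_le.2 ⟨by linarith [hmono hkl, hmono hkm], by linarith [hmono hml]⟩
      rw [Fin.card_Icc] at hIcc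
      lia
    · have hIic := hcard_of_subset k (Finset.Iic k) fun m hm => by
        have hmk := hmono (Finset.mem_Iic.1 hm)
        exact abs_le.2 ⟨by linarith [(hθ m).1], by linarith⟩
      have hIci := hcard_of_subset l (Finset.Ici l) fun m hm => by
        have hlm := hmono (Finset.mem_Ici.1 hm)
        exact abs_le.2 ⟨by linarith, by linarith [(hθ m).2]⟩
      rw [Fin.card_Iic] at hIic
      rw [Fin.card_Ici] at hIci
      lia
  intro k l hkl
  rcases le_total k l with hle | hle
  · have := hupper k l hle (hA k l hkl)
    lia
  · have := hupper l k hle (dist_comm (θ k : UnitAddCircle) (θ l) ▸ hA k l hkl)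
    lia

theorem IsBandedUpToCorners.mono {n p q : ℕ} {A : Matrix (Fin n) (Fin n) ℝ}
    (hA : IsBandedUpToCorners p A) (hpq : p ≤ q) : IsBandedUpToCorners q A := by
  intro i j hij
  have := hA i j hij
  lia

namespace PLGOrdering

variable {r : ℕ} {Ω : Set Plane} {γ : Fin r → JordanCurve} {E : EllipticProblem} {h : ℝ}
  {𝒞 : Idx → Set Plane} (o : PLGOrdering Ω γ E h 𝒞)

/-- The closest boundary points by which the cells are ordered have distance at most `ρ * h` from
the centers of their cells. -/
def IsNear (ρ : ℝ) : Prop :=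
  ∀ c k, dist (cellCenter h (o.cell ⟨c, k⟩)) ((γ c).toFun (o.param c k)) ≤ ρ * h

theorem isNear_seven (hΩ : IsDomainWithBoundary Ω γ) {ε : ℝ} (hh : 0 < h) (hε : ε ≤ 1)
    (h𝒞 : IsMergedCutCells Ω h ε 𝒞) : o.IsNear 7 := by
  intro c k
  obtain ⟨x, hx, hdist⟩ := exists_mem_frontier_dist_le_of_mem_plgCells hΩ.regularOpen hΩ.bounded
    hh hε h𝒞 (o.range_cell ▸ mem_range_self (⟨c, k⟩ : Σ c, Fin (o.size c)))
  exact (o.closest c k x hx).trans hdist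

theorem sum_size : ∑ c, o.size c = (plgCells Ω E h 𝒞).ncard := by
  rw [← o.range_cell, ← image_univ, ncard_image_of_injective _ o.cell_injective, ncard_univ,
    Nat.card_sigma]
  simp only [Nat.card_eq_fintype_card, Fintype.card_fin]

theorem param_mem_Icc (c : Fin r) (k : Fin (o.size c)) : o.param c k ∈ Icc (0 : ℝ) 1 :=
  Ico_subset_Icc_self (o.param_mem c k)

variable {o} {R : ℕ} {T : Idx → Finset Idx} {ρ : ℝ}

theorem abs_sub_le_of_A22_ne_zero (hT : ∀ i ∈ plgCells Ω E h 𝒞, IsPLGStencil R 𝒞 i (T i))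
    {x y : Σ c, Fin (o.size c)} (hxy : o.A22 T x y ≠ 0) (d : Fin 2) :
    |o.cell y d - o.cell x d| ≤ R := by
  have hmem : o.cell y ∈ T (o.cell x) := by
    by_contra hmem
    exact hxy (dif_neg hmem)
  obtain ⟨⟨b, hx, hy⟩, -⟩ := hT (o.cell x) (o.range_cell ▸ mem_range_self x)
  have hxd := hx d
  have hyd := hy _ hmem d
  exact abs_le.2 ⟨by lia, by lia⟩

theorem IsNear.dist_le_of_A22_ne_zero (ho : o.IsNear ρ) (hh : 0 < h)
    (hT : ∀ i ∈ plgCells Ω E h 𝒞, IsPLGStencil R 𝒞 i (T i)) {c c' : Fin r}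
    {k : Fin (o.size c)} {l : Fin (o.size c')} (hkl : o.A22 T ⟨c, k⟩ ⟨c', l⟩ ≠ 0) :
    dist ((γ c).toFun (o.param c k)) ((γ c').toFun (o.param c' l)) ≤
      (2 * ρ + 2 * R + 1) * h := by
  have hcenters : dist (cellCenter h (o.cell ⟨c, k⟩)) (cellCenter h (o.cell ⟨c', l⟩)) ≤
      (2 * R + 1) * h := by
    rw [dist_comm]
    exact_mod_cast dist_cellCenter_le_of_mem_gridCell hh (abs_sub_le_of_A22_ne_zero hT hkl)
      (cellCenter_mem_gridCell hh _)
  calc _ ≤ _ := dist_triangle4 _ (cellCenter h (o.cell ⟨c, k⟩))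
        (cellCenter h (o.cell ⟨c', l⟩)) _
    _ ≤ ρ * h + (2 * R + 1) * h + ρ * h := by
      gcongr
      · exact dist_comm (cellCenter h (o.cell ⟨c, k⟩)) _ ▸ ho c k
      · exact ho c' l
    _ = (2 * ρ + 2 * R + 1) * h := by ring

theorem IsNear.card_filter_abs_param_sub_le (ho : o.IsNear ρ) (hh : 0 < h) {c : Fin r}
    {L : NNReal} (hL : LipschitzOnWith L (γ c).toFun (Icc 0 1)) (Δ : ℝ) (k : Fin (o.size c)) :
    (Finset.univ.filter fun m => |o.param c m - o.param c k| ≤ Δ * h).card ≤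
      (⌊2 * (ρ + L * Δ)⌋₊ + 1) ^ 2 := by
  refine (Finset.card_le_card_of_injOn (fun m => o.cell ⟨c, m⟩) ?_ ?_).trans
    (card_cellsNear_le h (ρ + L * Δ) ((γ c).toFun (o.param c k)))
  · intro m hm
    have hmk : dist (o.param c m) (o.param c k) ≤ Δ * h := (Finset.mem_filter.1 hm).2
    refine mem_cellsNear hh ?_
    calc _ ≤ _ := dist_triangle _ ((γ c).toFun (o.param c m)) _
      _ ≤ ρ * h + L * (Δ * h) := by
        gcongr
        · exact ho c m
        · exact (hL.dist_le_mul _ (o.param_mem_Icc c m) _ (o.param_mem_Icc c k)).trans (by gcongr)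
      _ = (ρ + L * Δ) * h := by ring
  · intro m _ m' _ hmm'
    simpa using o.cell_injective hmm'

theorem exists_isBandedUpToCorners_A22Block (hγ : ∀ c, (γ c).NoCusp) (R : ℕ) (ρ : ℝ) :
    ∃ p : ℕ, ∀ {E : EllipticProblem} {h : ℝ} {𝒞 : Idx → Set Plane}
      {o : PLGOrdering Ω γ E h 𝒞} {T : Idx → Finset Idx}, 0 < h → o.IsNear ρ →
      (∀ i ∈ plgCells Ω E h 𝒞, IsPLGStencil R 𝒞 i (T i)) →
      ∀ c, IsBandedUpToCorners p (o.A22Block T c) := by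
  choose L hL using fun c => (γ c).exists_lipschitzOnWith
  choose K hK using fun c => (hγ c).exists_antilipschitzWith_loop
  let Δ (c : Fin r) : ℝ := K c * (2 * ρ + 2 * R + 1)
  let width (c : Fin r) : ℕ := (⌊2 * (ρ + L c * Δ c)⌋₊ + 1) ^ 2
  refine ⟨Finset.univ.sup width, fun {E h 𝒞 o T} hh ho hT c => ?_⟩
  refine (isBandedUpToCorners_of_dist_coe_le (p := width c) (Δ := Δ c * h) (o.param_monotone c)
    (o.param_mem_Icc c) (ho.card_filter_abs_param_sub_le hh (hL c) (Δ c))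
    fun k l hkl => ?_).mono (Finset.le_sup (Finset.mem_univ c))
  calc dist (o.param c k : UnitAddCircle) (o.param c l)
      ≤ K c * dist ((γ c).toFun (o.param c k)) ((γ c).toFun (o.param c l)) := by
        simpa only [(γ c).loop_coe (o.param_mem_Icc c _)] using
          (hK c).le_mul_dist (o.param c k) (o.param c l)
    _ ≤ K c * ((2 * ρ + 2 * R + 1) * h) := by
        gcongr
        exact ho.dist_le_of_A22_ne_zero hh hT hkl
    _ = Δ c * h := (mul_assoc _ _ _).symm

theorem exists_A22_eq_blockDiagonal'
    (hdisj : Pairwise fun c c' => Disjoint (γ c).trace (γ c').trace) (R : ℕ) (ρ : ℝ) :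
    ∃ h₀ > 0, ∀ {E : EllipticProblem} {h : ℝ} {𝒞 : Idx → Set Plane}
      {o : PLGOrdering Ω γ E h 𝒞} {T : Idx → Finset Idx}, 0 < h → h ≤ h₀ → o.IsNear ρ →
      (∀ i ∈ plgCells Ω E h 𝒞, IsPLGStencil R 𝒞 i (T i)) →
      o.A22 T = Matrix.blockDiagonal' (o.A22Block T) := by
  obtain ⟨δ, hδ, hsep⟩ :=
    exists_pos_lt_dist_of_pairwise_disjoint (fun c => (γ c).isCompact_trace) hdisj
  refine ⟨δ / (|2 * ρ + 2 * R + 1| + 1), by positivity, fun {E h 𝒞 o T} hh hh₀ ho hT => ?_⟩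
  ext ⟨c, k⟩ ⟨c', l⟩
  by_cases hc : c = c'
  · subst hc
    rw [Matrix.blockDiagonal'_apply_eq]
    rfl
  · rw [Matrix.blockDiagonal'_apply_ne _ _ _ hc]
    by_contra hne
    rw [le_div_iff₀ (by positivity)] at hh₀
    have hclose := ho.dist_le_of_A22_ne_zero hh hT hne
    have hfar := hsep c c' hc _ (mem_image_of_mem _ (o.param_mem_Icc c k)) _
      (mem_image_of_mem _ (o.param_mem_Icc c' l))
    nlinarith [le_abs_self (2 * ρ + 2 * R + 1)]

theorem sum_cost_runLU_le (o : PLGOrdering Ω γ E h 𝒞) (T : Idx → Finset Idx) (p : ℕ) :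
    ∑ c, (runLU p (o.A22Block T c)).cost ≤ (10 * p ^ 2 + 3 * p) * ∑ c, o.size c := by
  rw [Finset.mul_sum]
  exact Finset.sum_le_sum fun c _ => cornerLU_cost_le p (o.size c) _

end PLGOrdering

theorem mainTheorem1 {r : ℕ} (Ω : Set Plane) (γ : Fin r → JordanCurve)
    (hΩ : IsDomainWithBoundary Ω γ) :
    (∃ C : ℝ, ∀ (E : EllipticProblem) (ε h : ℝ), 0 < ε → ε < 1 → 0 < h → h ≤ 1 →
      ∀ 𝒞 : Idx → Set Plane, IsMergedCutCells Ω h ε 𝒞 →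
        (plgCells Ω E h 𝒞).Finite ∧ ((plgCells Ω E h 𝒞).ncard : ℝ) ≤ C / h) ∧
    ((∀ c, (γ c).NoCusp) → (∀ c c', c ≠ c' → Disjoint (γ c).trace (γ c').trace) →
      ∀ R : ℕ, ∃ (C : ℝ) (p : ℕ) (h₀ : ℝ), 0 < h₀ ∧
        ∀ (E : EllipticProblem) (ε h : ℝ), 0 < ε → ε < 1 → 0 < h → h ≤ h₀ →
        ∀ 𝒞 : Idx → Set Plane, IsMergedCutCells Ω h ε 𝒞 →
        ∀ T : Idx → Finset Idx, (∀ i ∈ plgCells Ω E h 𝒞, IsPLGStencil R 𝒞 i (T i)) →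
        ∀ o : PLGOrdering Ω γ E h 𝒞,
          ((∑ c, o.size c : ℕ) : ℝ) ≤ C / h ∧
          o.A22 T = Matrix.blockDiagonal' (o.A22Block T) ∧
          (∀ c, IsBandedUpToCorners p (o.A22Block T c)) ∧
          ((∑ c, (runLU p (o.A22Block T c)).cost : ℕ) : ℝ) ≤ C / h ∧
          ((∀ c, HasNonzeroPivots (o.A22Block T c)) →
            Matrix.blockDiagonal'
                (fun c => lowerFactor (o.size c) (runLU p (o.A22Block T c)).val) *
              Matrix.blockDiagonal'
                (fun c => upperFactor (o.size c) (runLU p (o.A22Block T c)).val) =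
              o.A22 T)) := by
  obtain ⟨B, hB⟩ := exists_ncard_plgCells_le hΩ
  refine ⟨⟨B, fun E ε h _ hε => hB E ε h hε.le⟩, fun hcusp hdisj R => ?_⟩
  obtain ⟨p, hp⟩ := PLGOrdering.exists_isBandedUpToCorners_A22Block (Ω := Ω) hcusp R 7
  obtain ⟨h₁, hh₁, hdiagonal⟩ :=
    PLGOrdering.exists_A22_eq_blockDiagonal' (Ω := Ω) (fun c c' => hdisj c c') R 7
  refine ⟨max B ((10 * p ^ 2 + 3 * p : ℕ) * B), p, min 1 h₁, lt_min one_pos hh₁,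
    fun E ε h _ hε hh hh₀ 𝒞 h𝒞 T hT o => ?_⟩
  obtain ⟨hh_one, hhh₁⟩ := le_min_iff.1 hh₀
  have ho := o.isNear_seven hΩ hh hε.le h𝒞
  have hband := hp hh ho hT
  have hdiag := hdiagonal hh hhh₁ ho hT
  have hsize : ((∑ c, o.size c : ℕ) : ℝ) ≤ B / h :=
    o.sum_size ▸ (hB E ε h hε.le hh hh_one 𝒞 h𝒞).2
  refine ⟨hsize.trans (by gcongr; exact le_max_left _ _), hdiag, hband, ?_, fun hpiv => ?_⟩
  · calc _ ≤ ((10 * p ^ 2 + 3 * p : ℕ) : ℝ) * (∑ c, o.size c : ℕ) := by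
          exact_mod_cast o.sum_cost_runLU_le T p
      _ ≤ (10 * p ^ 2 + 3 * p : ℕ) * B / h := by
          rw [mul_div_assoc]
          gcongr
      _ ≤ _ := by gcongr; exact le_max_right _ _
  · rw [← Matrix.blockDiagonal'_mul, hdiag]
    exact congrArg _ (funext fun c => (hband c).lowerFactor_mul_upperFactor (hpiv c))
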